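/- For a finite poset $P$, a family $\mathcal F$ of subsets of $[n]=\{1,\dots,n\}$, ordered by inclusion, is called $P$-saturated if $\mathcal F$ contains no induced copy of $P$ (that is, there is no order embedding $P\hookrightarrow\mathcal F$), but for every $S\subseteq[n]$ with $S\notin\mathcal F$ the family $\mathcal F\cup\{S\}$ contains an induced copy of $P$. Let $\mathrm{sat}^*(n,P)$ be the smallest size of a $P$-saturated family of subsets of $[n]$. For $k\ge 1$ and positive integers $n_1,\dots,n_k$, let $K_{n_1,\dots,n_k}$ be the complete multipartite poset with $k$ layers of sizes $n_1,\dots,n_k$ from bottom to top: each layer is an antichain, and every element of a lower layer is strictly below every element of a higher layer. Theorem. Let $k\ge 1$ and let $n_1,\dots,n_k$ be fixed positive integers. If $n_1=\dots=n_k=1$, then $\mathrm{sat}^*(n,K_{n_1,\dots,n_k})=O(1)$ as $n\to\infty$. Otherwise, $\mathrm{sat}^*(n,K_{n_1,\dots,n_k})=\Theta(n)$ as $n\to\infty$. -/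

import Mathlib

open Asymptotics Filter

/-- The family `F` of subsets of `[n]`, ordered by inclusion, contains an induced copy of the
poset `P`. -/
def HasInducedCopy (P : Type*) [PartialOrder P] {n : ℕ} (F : Finset (Finset (Fin n))) : Prop :=
  Nonempty (P ↪o {A : Finset (Fin n) // A ∈ F})

/-- `F` is `P`-saturated: it has no induced copy of `P`, but adding any set outside `F` creates
one. -/
def IsSaturated (P : Type*) [PartialOrder P] {n : ℕ} (F : Finset (Finset (Fin n))) : Prop :=
  ¬ HasInducedCopy P F ∧ ∀ S : Finset (Fin n), S ∉ F → HasInducedCopy P (insert S F)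

/-- The induced saturation number `sat*(n, P)`: the smallest size of a `P`-saturated family of
subsets of `[n]`. The minimum is over a nonempty set whenever `P` is nonempty, see
`exists_isSaturated`. -/
noncomputable def inducedSat (n : ℕ) (P : Type*) [PartialOrder P] : ℕ :=
  sInf {c : ℕ | ∃ F : Finset (Finset (Fin n)), IsSaturated P F ∧ F.card = c}

theorem exists_isSaturated (n : ℕ) (P : Type*) [PartialOrder P] [Nonempty P] :
    ∃ F : Finset (Finset (Fin n)), IsSaturated P F := by
  classical
  have hne : (Finset.univ.filter
      (fun F : Finset (Finset (Fin n)) => ¬ HasInducedCopy P F)).Nonempty := by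
    refine ⟨∅, ?_⟩
    simp only [Finset.mem_filter, Finset.mem_univ, true_and]
    rintro ⟨f⟩
    obtain ⟨p⟩ := ‹Nonempty P›
    exact absurd (f p).2 (Finset.notMem_empty _)
  obtain ⟨F, hF, hmax⟩ := Finset.exists_max_image _ Finset.card hne
  refine ⟨F, (Finset.mem_filter.1 hF).2, fun S hS => ?_⟩
  by_contra hcon
  have h := hmax (insert S F) (Finset.mem_filter.2 ⟨Finset.mem_univ _, hcon⟩)
  rw [Finset.card_insert_of_notMem hS] at h
  omega

/-- The underlying set of the complete multipartite poset `K_{n_1,…,n_k}`: an element is a pair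
consisting of a layer `i` and one of the `s i` elements of this layer. -/
structure MultipartitePoset {k : ℕ} (s : Fin k → ℕ) where
  /-- The layer of the element; layer `0` is the bottom layer. -/
  layer : Fin k
  /-- The element within its layer. -/
  elt : Fin (s layer)

/-- Each layer is an antichain, and every element of a lower layer is strictly below every element
of a higher layer. -/
instance {k : ℕ} (s : Fin k → ℕ) : PartialOrder (MultipartitePoset s) where
  le a b := a = b ∨ a.layer < b.layer
  le_refl a := Or.inl rfl
  le_trans a b c hab hbc := by
    rcases hab with rfl | hab
    · exact hbc
    · rcases hbc with rfl | hbc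
      · exact Or.inr hab
      · exact Or.inr (hab.trans hbc)
  le_antisymm a b hab hba := by
    rcases hab with rfl | hab
    · rfl
    · rcases hba with rfl | hba
      · rfl
      · exact absurd (hab.trans hba) (lt_irrefl _)

/-! Two bounds suffice: `n ≤ sat* + 1` when some layer has at least two elements, and `sat* ≤ (2 + B
(n + 1)) 2 ^ m`, with `m` independent of `n < ∞` and `n > m`, when all layers have at most `B + 1`
elements. The case `B = 0` of the latter gives `O(1)`.

Lower bound. If `|F| + 2 ≤ n`, some nonzero real function on `[n]` sums to 0 over `[n]` and over
every member of `F`. Let `W` be its support and `P` its positive part. A member of `F` whose trace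
on `W` lies in `P` misses `W`; one containing `P` or `W \ P` contains `W`. So for `Z` disjoint from
`W` the set `P ∪ Z` is not in `F`, and in the copy it creates the lower layers lie inside `Z` and
the upper ones contain `W ∪ Z`. The layer of `P ∪ Z` is the rank of `Z`; it is unique and monotone.
Extremal choices then let a member of `F` replace the added set, so that `F` itself has a copy:
first if a member cuts `W` nontrivially (`trivial_of_mem`), then if a layer has two elements
(`false_of_isBalanced`).

Upper bound. On a set `Y` of constant size a copy-free template is built that offers, for every `Z ⊆
Y`, all layers but one, inside `Z` or around `Z ∪ Yᶜ`. In a saturated family containing it, at most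
`B` sets of each cardinality lie strictly between `Z` and `Z ∪ Yᶜ` with trace `Z`, since more would
fill the missing layer. Layers of size one use full levels of `Y`; larger layers use sparse covers,
which exist by a local lemma proved by counting. -/

/-! ### Copies of the poset as sequences of layers -/

/-- `L` describes the layers with index in `I` of an induced copy, inside `F`, of the complete
multipartite poset with layer sizes `s`. -/
def IsLayered {α : Type*} (s : ℕ → ℕ) (I : Set ℕ) (F : Finset (Finset α))
    (L : ℕ → Finset (Finset α)) : Prop :=
  (∀ i ∈ I, L i ⊆ F ∧ (L i).card = s i ∧ IsAntichain (· ⊆ ·) (L i : Set (Finset α))) ∧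
    ∀ i ∈ I, ∀ j ∈ I, i < j → ∀ A ∈ L i, ∀ B ∈ L j, A ⊂ B

/-- Layer sizes extended to all natural numbers. -/
def layerSize {k : ℕ} (s : Fin k → ℕ) (i : ℕ) : ℕ := if h : i < k then s ⟨i, h⟩ else 1

theorem layerSize_of_lt {k : ℕ} (s : Fin k → ℕ) {i : ℕ} (h : i < k) :
    layerSize s i = s ⟨i, h⟩ := dif_pos h

theorem hasInducedCopy_iff {k n : ℕ} (s : Fin k → ℕ) (F : Finset (Finset (Fin n))) :
    HasInducedCopy (MultipartitePoset s) F ↔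
      ∃ L, IsLayered (layerSize s) (Set.Iio k) F L := by
  constructor
  · rintro ⟨f⟩
    have hle : ∀ a b, (f a).1 ⊆ (f b).1 ↔ a = b ∨ a.layer < b.layer := fun a b =>
      f.map_rel_iff (a := a) (b := b)
    refine ⟨fun i => if h : i < k then
      Finset.univ.image (fun a : Fin (s ⟨i, h⟩) => (f ⟨⟨i, h⟩, a⟩).1) else ∅, ?_, ?_⟩
    · intro i hi
      have hi : i < k := hi
      simp only [hi, dif_pos]
      refine ⟨?_, ?_, ?_⟩
      · intro A hA
        obtain ⟨a, -, rfl⟩ := Finset.mem_image.1 hA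
        exact (f _).2
      · rw [Finset.card_image_of_injective, Finset.card_univ, Fintype.card_fin,
          layerSize_of_lt s hi]
        intro a b hab
        have := f.injective (Subtype.ext hab)
        simpa using this
      · intro A hA B hB hAB hsub
        simp only [Finset.coe_image, Finset.coe_univ, Set.image_univ, Set.mem_range] at hA hB
        obtain ⟨a, rfl⟩ := hA
        obtain ⟨b, rfl⟩ := hB
        rcases (hle _ _).1 hsub with h | h
        · exact hAB (by rw [h])
        · exact absurd h (lt_irrefl _)
    · intro i hi j hj hij A hA B hB
      have hi : i < k := hi
      have hj : j < k := hj
      simp only [hi, hj, dif_pos] at hA hB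
      obtain ⟨a, -, rfl⟩ := Finset.mem_image.1 hA
      obtain ⟨b, -, rfl⟩ := Finset.mem_image.1 hB
      refine ⟨(hle _ _).2 (Or.inr (by simpa using hij)), fun h => ?_⟩
      rcases (hle _ _).1 h with h | h
      · have := congrArg MultipartitePoset.layer h
        simp only [Fin.mk.injEq] at this
        omega
      · simp only [Fin.mk_lt_mk] at h
        omega
  · rintro ⟨L, hL, hlt⟩
    have hc : ∀ i : Fin k, (L i).card = s i := fun i => by
      rw [(hL i i.2).2.1, layerSize_of_lt s i.2]
    let e : ∀ i : Fin k, Fin (s i) ≃ L i := fun i => (Finset.equivFinOfCardEq (hc i)).symm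
    refine ⟨OrderEmbedding.ofMapLEIff
      (fun p => ⟨(e p.layer p.elt).1, (hL _ p.layer.2).1 (e p.layer p.elt).2⟩) ?_⟩
    rintro ⟨i, a⟩ ⟨j, b⟩
    change (e i a).1 ⊆ (e j b).1 ↔ (_ = _ ∨ i < j)
    rcases lt_trichotomy i j with h | h | h
    · exact ⟨fun _ => Or.inr h, fun _ => (hlt i i.2 j j.2 h _ (e i a).2 _ (e j b).2).1⟩
    · subst h
      constructor
      · intro hs
        left
        by_contra hne
        have : (e i a).1 ≠ (e i b).1 := fun h => hne (by
          rw [(e i).injective (Subtype.ext h)])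
        exact (hL i i.2).2.2 (e i a).2 (e i b).2 this hs
      · rintro (h | h)
        · simp only [MultipartitePoset.mk.injEq, heq_eq_eq, true_and] at h
          rw [h]
        · exact absurd h (lt_irrefl _)
    · have h1 := hlt j j.2 i i.2 h _ (e j b).2 _ (e i a).2
      constructor
      · intro hs
        exact absurd hs h1.2
      · rintro (h2 | h2)
        · simp only [MultipartitePoset.mk.injEq] at h2
          exact absurd h2.1 h.ne'
        · exact absurd h2 h.asymm

theorem IsLayered.mono {α : Type*} {s : ℕ → ℕ} {I J : Set ℕ} {F F' : Finset (Finset α)}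
    {L : ℕ → Finset (Finset α)} (h : IsLayered s I F L) (hJ : J ⊆ I)
    (hF : ∀ i ∈ J, L i ⊆ F') : IsLayered s J F' L :=
  ⟨fun i hi => ⟨hF i hi, (h.1 i (hJ hi)).2⟩, fun i hi j hj => h.2 i (hJ hi) j (hJ hj)⟩

/-- Gluing lower layers and upper layers. -/
theorem IsLayered.glue {α : Type*} {s : ℕ → ℕ} {k c : ℕ} {F : Finset (Finset α)}
    {L₁ L₂ : ℕ → Finset (Finset α)} (h₁ : IsLayered s (Set.Iio c) F L₁)
    (h₂ : IsLayered s (Set.Ico c k) F L₂)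
    (h : ∀ i < c, ∀ j ∈ Set.Ico c k, ∀ A ∈ L₁ i, ∀ B ∈ L₂ j, A ⊂ B) :
    IsLayered s (Set.Iio k) F (fun i => if i < c then L₁ i else L₂ i) := by
  constructor
  · intro i hi
    by_cases hic : i < c
    · simpa only [hic, if_true] using h₁.1 i hic
    · simpa only [hic, if_false] using h₂.1 i ⟨not_lt.1 hic, hi⟩
  · intro i hi j hj hij A hA B hB
    by_cases hic : i < c <;> by_cases hjc : j < c <;>
      simp only [hic, hjc, if_true, if_false] at hA hB
    · exact h₁.2 i hic j hjc hij A hA B hB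
    · exact h i hic j ⟨not_lt.1 hjc, hj⟩ A hA B hB
    · omega
    · exact h₂.2 i ⟨not_lt.1 hic, hi⟩ j ⟨not_lt.1 hjc, hj⟩ hij A hA B hB

/-- Gluing lower layers, one middle layer and upper layers. -/
theorem IsLayered.glue_middle {α : Type*} {s : ℕ → ℕ} {k c : ℕ} {F : Finset (Finset α)}
    {L₁ L₂ : ℕ → Finset (Finset α)} {M : Finset (Finset α)}
    (h₁ : IsLayered s (Set.Iio c) F L₁) (h₂ : IsLayered s (Set.Ioo c k) F L₂)
    (hMF : M ⊆ F) (hMc : M.card = s c) (hsc : 0 < s c)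
    (hMa : IsAntichain (· ⊆ ·) (M : Set (Finset α)))
    (hlow : ∀ i < c, ∀ A ∈ L₁ i, ∀ B ∈ M, A ⊂ B)
    (hup : ∀ i ∈ Set.Ioo c k, ∀ B ∈ L₂ i, ∀ A ∈ M, A ⊂ B) :
    ∃ L, IsLayered s (Set.Iio k) F L := by
  obtain ⟨C, hC⟩ := Finset.card_pos.1 (hMc ▸ hsc)
  refine ⟨_, IsLayered.glue (L₂ := fun i => if i = c then M else L₂ i) h₁ ⟨?_, ?_⟩ ?_⟩
  · intro i hi
    by_cases hic : i = c
    · subst hic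
      simpa using ⟨hMF, hMc, hMa⟩
    · simpa only [hic, if_false] using h₂.1 i ⟨lt_of_le_of_ne hi.1 (Ne.symm hic), hi.2⟩
  · intro i hi j hj hij A hA B hB
    have hjc : j ≠ c := by have := hi.1; omega
    have hj' : j ∈ Set.Ioo c k := ⟨lt_of_le_of_ne hj.1 (Ne.symm hjc), hj.2⟩
    by_cases hic : i = c
    · simp only [hic, hjc, if_true, if_false] at hA hB
      exact hup j hj' B hB A hA
    · simp only [hic, hjc, if_false] at hA hB
      exact h₂.2 i ⟨lt_of_le_of_ne hi.1 (Ne.symm hic), hi.2⟩ j hj' hij A hA B hB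
  · intro i hi j hj A hA B hB
    by_cases hjc : j = c
    · simp only [hjc, if_true] at hB
      exact hlow i hi A hA B hB
    · simp only [hjc, if_false] at hB
      exact (hlow i hi A hA C hC).trans
        (hup j ⟨lt_of_le_of_ne hj.1 (Ne.symm hjc), hj.2⟩ B hB C hC)

/-! ### Balanced pairs from linear algebra -/

/-- `P ⊂ W` are such that no member of `F` is cut by `W` exactly inside `P`, and every member of
`F` containing `P` or `W \ P` contains `W`. -/
structure IsBalanced {α : Type*} [DecidableEq α] (F : Finset (Finset α)) (W P : Finset α) :
    Prop where
  nonempty : P.Nonempty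
  ssubset : P ⊂ W
  disjoint_of_inter_subset : ∀ A ∈ F, A ∩ W ⊆ P → Disjoint A W
  subset_of_subset : ∀ A ∈ F, P ⊆ A → W ⊆ A
  subset_of_sdiff_subset : ∀ A ∈ F, W \ P ⊆ A → W ⊆ A

/-- There are `|F| + 1` linear conditions on `n` unknowns, hence a nonzero solution `f`. A vanishing
sum of terms of one sign vanishes termwise; applied to a member or to its complement, this gives the
three trace conditions. -/
theorem exists_isBalanced {n : ℕ} (F : Finset (Finset (Fin n))) (h : F.card + 2 ≤ n) :
    ∃ W P, IsBalanced F W P := by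
  classical
  let T : (Fin n → ℝ) →ₗ[ℝ] (Option F → ℝ) :=
    { toFun := fun f o => match o with
        | none => ∑ x, f x
        | some A => ∑ x ∈ A.1, f x
      map_add' := fun f g => by
        funext o
        cases o <;> simp [Finset.sum_add_distrib]
      map_smul' := fun c f => by
        funext o
        cases o <;> simp [Finset.mul_sum] }
  have hker : LinearMap.ker T ≠ ⊥ := by
    apply LinearMap.ker_ne_bot_of_finrank_lt
    simp only [Module.finrank_fintype_fun_eq_card, Fintype.card_option, Fintype.card_coe,
      Fintype.card_fin]
    omega
  obtain ⟨f, hf, hf0⟩ := (Submodule.ne_bot_iff _).1 hker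
  have hT : T f = 0 := hf
  have hu : ∑ x, f x = 0 := congrFun hT none
  have hA : ∀ A ∈ F, ∑ x ∈ A, f x = 0 := fun A hA => congrFun hT (some ⟨A, hA⟩)
  have hc : ∀ A ∈ F, ∑ x ∈ Aᶜ, f x = 0 := fun A hAF => by
    have := Finset.sum_add_sum_compl A f
    rw [hA A hAF, hu] at this
    linarith
  have key1 : ∀ A : Finset (Fin n), ∑ x ∈ A, f x = 0 → (∀ x ∈ A, 0 ≤ f x) → ∀ x ∈ A, f x = 0 :=
    fun A h0 hp => (Finset.sum_eq_zero_iff_of_nonneg hp).1 h0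
  have key2 : ∀ A : Finset (Fin n), ∑ x ∈ A, f x = 0 → (∀ x ∈ A, f x ≤ 0) → ∀ x ∈ A, f x = 0 :=
    fun A h0 hp => (Finset.sum_eq_zero_iff_of_nonpos hp).1 h0
  obtain ⟨z, hz⟩ := Function.ne_iff.1 hf0
  have hz : f z ≠ 0 := hz
  refine ⟨Finset.univ.filter (fun x => f x ≠ 0), Finset.univ.filter (fun x => 0 < f x),
    ?_, ?_, ?_, ?_, ?_⟩
  · by_contra hne
    rw [Finset.not_nonempty_iff_eq_empty, Finset.filter_eq_empty_iff] at hne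
    exact hz (key2 _ hu (fun x _ => not_lt.1 (hne (Finset.mem_univ x))) z (Finset.mem_univ z))
  · refine ⟨fun x hx => ?_, fun hsub => ?_⟩
    · simp only [Finset.mem_filter, Finset.mem_univ, true_and] at hx ⊢
      exact hx.ne'
    · refine hz (key1 _ hu (fun x _ => ?_) z (Finset.mem_univ z))
      by_contra hx
      have := @hsub x (by simpa using (not_le.1 hx).ne)
      simp only [Finset.mem_filter, Finset.mem_univ, true_and] at this
      exact hx this.le
  · intro A hAF hsub
    rw [Finset.disjoint_left]
    intro x hxA hxW
    refine (Finset.mem_filter.1 hxW).2 (key1 A (hA A hAF) (fun y hy => ?_) x hxA)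
    by_contra hy0
    have := @hsub y (by simpa [hy] using (not_le.1 hy0).ne)
    simp only [Finset.mem_filter, Finset.mem_univ, true_and] at this
    exact hy0 this.le
  · intro A hAF hsub x hxW
    by_contra hxA
    refine (Finset.mem_filter.1 hxW).2 (key2 Aᶜ (hc A hAF) (fun y hy => ?_) x
      (Finset.mem_compl.2 hxA))
    by_contra hy0
    exact Finset.mem_compl.1 hy (hsub (by simpa using hy0))
  · intro A hAF hsub x hxW
    by_contra hxA
    refine (Finset.mem_filter.1 hxW).2 (key1 Aᶜ (hc A hAF) (fun y hy => ?_) x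
      (Finset.mem_compl.2 hxA))
    by_contra hy0
    refine Finset.mem_compl.1 hy (hsub ?_)
    simpa using ⟨(not_le.1 hy0).ne, (not_le.1 hy0).le⟩

/-! ### Ranks, and the contradiction from a balanced pair -/

section Rank

variable {α : Type*} [DecidableEq α]

/-- The layers below `c` embed into `F` below `Z`. -/
def HasLower {α : Type*} (s : ℕ → ℕ) (F : Finset (Finset α)) (c : ℕ) (Z : Finset α) : Prop :=
  ∃ L, IsLayered s (Set.Iio c) F L ∧ ∀ i < c, ∀ A ∈ L i, A ⊆ Z

/-- The layers above `c` embed into `F` above `Z`. -/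
def HasUpper {α : Type*} (s : ℕ → ℕ) (k : ℕ) (F : Finset (Finset α)) (c : ℕ) (Z : Finset α) : Prop :=
  ∃ L, IsLayered s (Set.Ioo c k) F L ∧ ∀ i ∈ Set.Ioo c k, ∀ A ∈ L i, Z ⊆ A

theorem HasLower.mono {α : Type*} {s : ℕ → ℕ} {F : Finset (Finset α)} {c d : ℕ} {Z Z' : Finset α}
    (h : HasLower s F c Z) (hdc : d ≤ c) (hZ : Z ⊆ Z') : HasLower s F d Z' := by
  obtain ⟨L, hL, hLZ⟩ := h
  have hsub : Set.Iio d ⊆ Set.Iio c := Set.Iio_subset_Iio hdc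
  exact ⟨L, hL.mono hsub fun i hi => (hL.1 i (hsub hi)).1,
    fun i hi A hA => (hLZ i (lt_of_lt_of_le hi hdc) A hA).trans hZ⟩

/-- `F` has no copy, but gets one when a set is added. -/
structure IsLayerSaturated {α : Type*} [DecidableEq α] (s : ℕ → ℕ) (k : ℕ) (F : Finset (Finset α)) : Prop where
  pos : ∀ i < k, 0 < s i
  free : ¬ ∃ L, IsLayered s (Set.Iio k) F L
  sat : ∀ S ∉ F, ∃ L, IsLayered s (Set.Iio k) (insert S F) L

variable {s : ℕ → ℕ} {k : ℕ} {F : Finset (Finset α)}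

theorem IsLayerSaturated.exists_copy (hF : IsLayerSaturated s k F) {S : Finset α} (hS : S ∉ F) :
    ∃ L, ∃ c < k, IsLayered s (Set.Iio k) (insert S F) L ∧ S ∈ L c ∧
      IsLayered s (Set.Iio c) F L ∧ IsLayered s (Set.Ioo c k) F L ∧
      (∀ A ∈ L c, A ≠ S → A ∈ F ∧ ¬ A ⊆ S ∧ ¬ S ⊆ A) := by
  obtain ⟨L, hL⟩ := hF.sat S hS
  have hex : ∃ c < k, S ∈ L c := by
    by_contra hcon
    push Not at hcon
    refine hF.free ⟨L, hL.mono subset_rfl fun i hi A hA => ?_⟩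
    rcases Finset.mem_insert.1 ((hL.1 i hi).1 hA) with rfl | h
    · exact absurd hA (hcon i hi)
    · exact h
  obtain ⟨c, hc, hSc⟩ := hex
  have hne : ∀ i < k, i ≠ c → L i ⊆ F := by
    intro i hi hic A hA
    rcases Finset.mem_insert.1 ((hL.1 i hi).1 hA) with rfl | h
    · rcases lt_or_gt_of_ne hic with h | h
      · exact absurd (hL.2 i hi c hc h _ hA _ hSc) (fun h => h.2 subset_rfl)
      · exact absurd (hL.2 c hc i hi h _ hSc _ hA) (fun h => h.2 subset_rfl)
    · exact h
  refine ⟨L, c, hc, hL, hSc, ?_, ?_, ?_⟩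
  · exact hL.mono (Set.Iio_subset_Iio hc.le) fun i hi =>
      hne i (lt_trans hi hc) (ne_of_lt hi)
  · exact hL.mono (fun i hi => hi.2) fun i hi => hne i hi.2 (ne_of_gt hi.1)
  · intro A hA hAS
    refine ⟨?_, (hL.1 c hc).2.2 hA hSc hAS, (hL.1 c hc).2.2 hSc hA hAS.symm⟩
    rcases Finset.mem_insert.1 ((hL.1 c hc).1 hA) with h | h
    · exact absurd h hAS
    · exact h

/-- Replacing, in a copy inside `insert S F`, the set `S` by a member `X` of `F`. -/
theorem IsLayerSaturated.replace (hF : IsLayerSaturated s k F) {S X : Finset α} (hX : X ∈ F)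
    {L : ℕ → Finset (Finset α)} {c : ℕ} (hc : c < k)
    (hL : IsLayered s (Set.Iio k) (insert S F) L) (hSc : S ∈ L c)
    (hmid : ∀ A ∈ L c, A ≠ S → A ∈ F ∧ ¬ A ⊆ X ∧ ¬ X ⊆ A)
    {L₁ L₂ : ℕ → Finset (Finset α)}
    (h₁ : IsLayered s (Set.Iio c) F L₁) (h₂ : IsLayered s (Set.Ioo c k) F L₂)
    (h₁X : ∀ i < c, ∀ A ∈ L₁ i, A ⊂ X)
    (h₁L : ∀ i < c, ∀ A ∈ L₁ i, ∀ B ∈ L c, A ⊂ B)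
    (h₂X : ∀ i ∈ Set.Ioo c k, ∀ A ∈ L₂ i, X ⊂ A)
    (h₂L : ∀ i ∈ Set.Ioo c k, ∀ A ∈ L₂ i, ∀ B ∈ L c, B ⊂ A) : False := by
  have hX' : X ∉ (L c).erase S := fun h =>
    (hmid X (Finset.mem_of_mem_erase h) (Finset.ne_of_mem_erase h)).2.1 subset_rfl
  refine hF.free (IsLayered.glue_middle (M := insert X ((L c).erase S)) h₁ h₂ ?_ ?_
    (hF.pos c hc) ?_ ?_ ?_)
  · intro A hA
    rcases Finset.mem_insert.1 hA with rfl | hA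
    · exact hX
    · exact (hmid A (Finset.mem_of_mem_erase hA) (Finset.ne_of_mem_erase hA)).1
  · rw [Finset.card_insert_of_notMem hX', Finset.card_erase_of_mem hSc, (hL.1 c hc).2.1]
    have := hF.pos c hc
    omega
  · intro A hA B hB hAB
    rcases Finset.mem_insert.1 (Finset.mem_coe.1 hA) with rfl | hA' <;>
      rcases Finset.mem_insert.1 (Finset.mem_coe.1 hB) with rfl | hB'
    · exact absurd rfl hAB
    · exact (hmid B (Finset.mem_of_mem_erase hB') (Finset.ne_of_mem_erase hB')).2.2
    · exact (hmid A (Finset.mem_of_mem_erase hA') (Finset.ne_of_mem_erase hA')).2.1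
    · exact (hL.1 c hc).2.2 (Finset.mem_of_mem_erase hA') (Finset.mem_of_mem_erase hB') hAB
  · intro i hi A hA B hB
    rcases Finset.mem_insert.1 hB with rfl | hB
    · exact h₁X i hi A hA
    · exact h₁L i hi A hA B (Finset.mem_of_mem_erase hB)
  · intro i hi A hA B hB
    rcases Finset.mem_insert.1 hB with rfl | hB
    · exact h₂X i hi A hA
    · exact h₂L i hi A hA B (Finset.mem_of_mem_erase hB)

variable {W P : Finset α}

/-- If `d < c`, the layers up to `d` inside `Z` and those above `d` around `W ∪ Z'` glue to a full
copy; the inclusions are strict because `Z` misses the nonempty `W`. -/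
theorem HasLower.le_of_hasUpper (hfree : ¬ ∃ L, IsLayered s (Set.Iio k) F L)
    (hW : W.Nonempty) {c d : ℕ} {Z Z' : Finset α}
    (hl : HasLower s F c Z) (hu : HasUpper s k F d (W ∪ Z')) (hZ : Z ⊆ Z')
    (hdis : Disjoint Z W) : c ≤ d := by
  by_contra hlt
  push Not at hlt
  have hl := hl.mono (show d + 1 ≤ c from hlt) subset_rfl
  obtain ⟨L₁, h₁, h₁Z⟩ := hl
  obtain ⟨L₂, h₂, h₂Z⟩ := hu
  have hsub : Set.Ico (d + 1) k ⊆ Set.Ioo d k := fun i hi => ⟨hi.1, hi.2⟩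
  refine hfree ⟨_, IsLayered.glue h₁ (h₂.mono hsub fun i hi => (h₂.1 i (hsub hi)).1) ?_⟩
  intro i hi j hj A hA B hB
  have hAZ := h₁Z i hi A hA
  have hBZ := h₂Z j (hsub hj) B hB
  refine ⟨(hAZ.trans hZ).trans (Finset.subset_union_right.trans hBZ), fun hBA => ?_⟩
  obtain ⟨w, hw⟩ := hW
  exact Finset.disjoint_left.1 hdis (hAZ (hBA (hBZ (Finset.mem_union_left _ hw)))) hw

/-- `c` is the layer into which sets cutting `W` nontrivially and agreeing with `Z` outside `W`
fit. -/
def IsRank (s : ℕ → ℕ) (k : ℕ) (F : Finset (Finset α)) (W : Finset α) (c : ℕ) (Z : Finset α) :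
    Prop :=
  c < k ∧ HasLower s F c Z ∧ HasUpper s k F c (W ∪ Z)

/-- Used in both directions with `Z = Z'`, this makes the rank unique. -/
theorem IsRank.le (hfree : ¬ ∃ L, IsLayered s (Set.Iio k) F L) (hW : W.Nonempty) {c d : ℕ}
    {Z Z' : Finset α} (hc : IsRank s k F W c Z) (hd : IsRank s k F W d Z') (hZ : Z ⊆ Z')
    (hdis : Disjoint Z W) : c ≤ d :=
  hc.2.1.le_of_hasUpper hfree hW hd.2.2 hZ hdis

theorem IsBalanced.disjoint_of_subset_union (hB : IsBalanced F W P) {A Z : Finset α} (hA : A ∈ F)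
    (hZ : Disjoint Z W) (h : A ⊆ P ∪ Z) : Disjoint A W ∧ A ⊆ Z := by
  have hd : Disjoint A W := hB.disjoint_of_inter_subset A hA fun x hx => by
    rcases Finset.mem_union.1 (h (Finset.mem_of_mem_inter_left hx)) with h' | h'
    · exact h'
    · exact absurd (Finset.mem_of_mem_inter_right hx) (Finset.disjoint_left.1 hZ h')
  refine ⟨hd, fun x hx => ?_⟩
  rcases Finset.mem_union.1 (h hx) with h' | h'
  · exact absurd (hB.ssubset.1 h') (Finset.disjoint_left.1 hd hx)
  · exact h'

theorem IsBalanced.union_notMem (hB : IsBalanced F W P) {Z : Finset α} (hZ : Disjoint Z W) :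
    P ∪ Z ∉ F := fun hS => by
  obtain ⟨x, hx⟩ := hB.nonempty
  exact Finset.disjoint_left.1 (hB.disjoint_of_subset_union hS hZ subset_rfl).1
    (Finset.mem_union_left _ hx) (hB.ssubset.1 hx)

theorem IsLayerSaturated.exists_copy_of_disjoint (hF : IsLayerSaturated s k F)
    (hB : IsBalanced F W P) {Z : Finset α} (hZ : Disjoint Z W) :
    ∃ L c, IsRank s k F W c Z ∧ IsLayered s (Set.Iio k) (insert (P ∪ Z) F) L ∧ P ∪ Z ∈ L c ∧
      IsLayered s (Set.Iio c) F L ∧ IsLayered s (Set.Ioo c k) F L ∧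
      (∀ A ∈ L c, A ≠ P ∪ Z → A ∈ F ∧ ¬ A ⊆ P ∪ Z ∧ ¬ P ∪ Z ⊆ A) ∧
      (∀ i < c, ∀ A ∈ L i, A ⊆ Z) ∧ (∀ i ∈ Set.Ioo c k, ∀ A ∈ L i, W ∪ Z ⊆ A) := by
  obtain ⟨L, c, hc, hL, hSc, h₁, h₂, hmid⟩ := hF.exists_copy (hB.union_notMem hZ)
  have hlow : ∀ i < c, ∀ A ∈ L i, A ⊆ Z := fun i hi A hA =>
    (hB.disjoint_of_subset_union ((h₁.1 i hi).1 hA) hZ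
      (hL.2 i (hi.trans hc) c hc hi A hA _ hSc).1).2
  have hup : ∀ i ∈ Set.Ioo c k, ∀ A ∈ L i, W ∪ Z ⊆ A := fun i hi A hA => by
    have hS := (hL.2 c hc i hi.2 hi.1 _ hSc A hA).1
    exact Finset.union_subset (hB.subset_of_subset A ((h₂.1 i hi).1 hA)
      (Finset.subset_union_left.trans hS)) (Finset.subset_union_right.trans hS)
  exact ⟨L, c, ⟨hc, ⟨L, h₁, hlow⟩, ⟨L, h₂, hup⟩⟩, hL, hSc, h₁, h₂, hmid, hlow, hup⟩

theorem IsLayerSaturated.exists_isRank (hF : IsLayerSaturated s k F)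
    (hB : IsBalanced F W P) {Z : Finset α} (hZ : Disjoint Z W) : ∃ c, IsRank s k F W c Z := by
  obtain ⟨L, c, h, -⟩ := hF.exists_copy_of_disjoint hB hZ
  exact ⟨c, h⟩

/-- No member of `F` cuts `W` nontrivially. -/
theorem IsLayerSaturated.trivial_of_mem (hF : IsLayerSaturated s k F)
    (hB : IsBalanced F W P) {X : Finset α} (hX : X ∈ F) : Disjoint X W ∨ W ⊆ X := by
  classical
  have hWne : W.Nonempty := hB.nonempty.mono hB.ssubset.1
  have hdis : ∀ A : Finset α, Disjoint (A \ W) W := fun A => Finset.sdiff_disjoint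
  by_contra hcon
  -- Among the members cutting `W`, choose `X` of least rank `c`, and then of largest cardinality.
  -- In the copy created by `X ∪ P`, this `X` will replace `X ∪ P`.
  have hex : ∃ c, ∃ X ∈ F, (¬ Disjoint X W ∧ ¬ W ⊆ X) ∧ IsRank s k F W c (X \ W) := by
    push Not at hcon
    obtain ⟨c, hc⟩ := hF.exists_isRank hB (hdis X)
    exact ⟨c, X, hX, hcon, hc⟩
  obtain ⟨c, hcex, hcmin⟩ : ∃ c, (∃ X ∈ F, (¬ Disjoint X W ∧ ¬ W ⊆ X) ∧
      IsRank s k F W c (X \ W)) ∧ ∀ d < c, ¬ ∃ X ∈ F, (¬ Disjoint X W ∧ ¬ W ⊆ X) ∧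
      IsRank s k F W d (X \ W) := ⟨Nat.find hex, Nat.find_spec hex, fun d hd => Nat.find_min hex hd⟩
  obtain ⟨X₀, hX₀, hX₀'⟩ := hcex
  obtain ⟨X, hX, hXmax⟩ := Finset.exists_max_image
    (F.filter fun X => (¬ Disjoint X W ∧ ¬ W ⊆ X) ∧ IsRank s k F W c (X \ W)) Finset.card
    ⟨X₀, Finset.mem_filter.2 ⟨hX₀, hX₀'⟩⟩
  obtain ⟨hXF, ⟨hXd, hXW⟩, hXr⟩ := Finset.mem_filter.1 hX
  have hXP : ¬ W \ P ⊆ X := fun h => hXW (hB.subset_of_sdiff_subset X hXF h)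
  have hWS : ¬ W ⊆ X ∪ P := fun h => hXP fun x hx => by
    rcases Finset.mem_union.1 (h (Finset.mem_sdiff.1 hx).1) with h' | h'
    · exact h'
    · exact absurd h' (Finset.mem_sdiff.1 hx).2
  have hS : X ∪ P ∉ F := fun h =>
    hWS (hB.subset_of_subset _ h Finset.subset_union_right)
  have hSsub : ∀ A : Finset α, A ⊆ X ∪ P → Disjoint A W → A ⊆ X \ W := fun A hA hAW x hx => by
    have hxW := Finset.disjoint_left.1 hAW hx
    rcases Finset.mem_union.1 (hA hx) with h | h
    · exact Finset.mem_sdiff.2 ⟨h, hxW⟩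
    · exact absurd (hB.ssubset.1 h) hxW
  obtain ⟨L, d, hd, hL, hSd, h₁, h₂, hmid⟩ := hF.exists_copy hS
  have hup : ∀ i ∈ Set.Ioo d k, ∀ A ∈ L i, W ⊆ A ∧ X ⊆ A := fun i hi A hA => by
    have hS := (hL.2 d hd i hi.2 hi.1 _ hSd A hA).1
    exact ⟨hB.subset_of_subset A ((h₂.1 i hi).1 hA)
      (Finset.subset_union_right.trans hS), Finset.subset_union_left.trans hS⟩
  have hupd : HasUpper s k F d (W ∪ X \ W) := ⟨L, h₂, fun i hi A hA =>
    Finset.union_subset (hup i hi A hA).1 (Finset.sdiff_subset.trans (hup i hi A hA).2)⟩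
  have hcd : c ≤ d := hXr.2.1.le_of_hasUpper hF.free hWne hupd subset_rfl (hdis X)
  -- Since `X ∪ P ⊆ W ∪ X`, if `c < d` the new copy's layers up to `c` would fit under the upper
  -- layers that the rank of `X` provides.
  have hdc : d ≤ c := by
    by_contra hlt
    push Not at hlt
    obtain ⟨L₂, hL₂, hL₂Z⟩ := hXr.2.2
    have hsub : Set.Ico (c + 1) k ⊆ Set.Ioo c k := fun i hi => ⟨hi.1, hi.2⟩
    have hsub' : Set.Iio (c + 1) ⊆ Set.Iio d := Set.Iio_subset_Iio hlt
    refine hF.free ⟨_, IsLayered.glue (h₁.mono hsub' fun i hi => (h₁.1 i (hsub' hi)).1)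
      (hL₂.mono hsub fun i hi => (hL₂.1 i (hsub hi)).1) ?_⟩
    intro i hi j hj A hA B hB'
    have hid : i < d := hsub' hi
    have hBZ := hL₂Z j (hsub hj) B hB'
    have hAS := hL.2 i (hid.trans hd) d hd hid A hA _ hSd
    refine hAS.trans_subset fun x hx => hBZ ?_
    rw [Finset.union_sdiff_self_eq_union]
    rcases Finset.mem_union.1 hx with h | h
    · exact Finset.mem_union_right _ h
    · exact Finset.mem_union_left _ (hB.ssubset.1 h)
  obtain rfl : c = d := le_antisymm hcd hdc
  -- lower layers disjoint from `W`
  have hlower : ∃ L₁, IsLayered s (Set.Iio c) F L₁ ∧ (∀ i < c, ∀ A ∈ L₁ i, Disjoint A W) ∧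
      ∀ i < c, ∀ A ∈ L₁ i, ∀ B ∈ L c, A ⊆ B := by
    by_cases hall : ∀ i < c, ∀ A ∈ L i, Disjoint A W
    · exact ⟨L, h₁, hall, fun i hi A hA B hB' =>
        (hL.2 i (hi.trans hd) c hd hi A hA B hB').1⟩
    · push Not at hall
      obtain ⟨j, hj, l, hl, hlW⟩ := hall
      have hlF := (h₁.1 j hj).1 hl
      have hlS := (hL.2 j (hj.trans hd) c hd hj l hl _ hSd).1
      -- A lower set `l` meeting `W` cuts it, so its rank is at least `c` by minimality, and the
      -- layers below `c` can be chosen anew inside `l \ W`.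
      obtain ⟨e, he⟩ := hF.exists_isRank hB (hdis l)
      have hce : c ≤ e := by
        by_contra hlt
        exact hcmin e (not_le.1 hlt) ⟨l, hlF, ⟨hlW, fun h => hWS (h.trans hlS)⟩, he⟩
      obtain ⟨L₁, hL₁, hL₁l⟩ := he.2.1.mono hce subset_rfl
      exact ⟨L₁, hL₁, fun i hi A hA => (hdis l).mono_left (hL₁l i hi A hA),
        fun i hi A hA B hB' => (hL₁l i hi A hA).trans (Finset.sdiff_subset.trans
          (hL.2 j (hj.trans hd) c hd hj l hl B hB').1)⟩
  obtain ⟨L₁, hL₁, hL₁W, hL₁L⟩ := hlower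
  have hmid' : ∀ A ∈ L c, A ≠ X ∪ P → A ∈ F ∧ ¬ A ⊆ X ∧ ¬ X ⊆ A := by
    intro A hA hAS
    obtain ⟨hAF, hAS1, hAS2⟩ := hmid A hA hAS
    refine ⟨hAF, fun h => hAS1 (h.trans Finset.subset_union_left), fun hXA => ?_⟩
    have hWA : ¬ W ⊆ A := fun h => hAS2 (Finset.union_subset hXA (hB.ssubset.1.trans h))
    have hAd : ¬ Disjoint A W := fun h => hXd (h.mono_left hXA)
    obtain ⟨e, he⟩ := hF.exists_isRank hB (hdis A)
    have hce : c ≤ e := hXr.le hF.free hWne he (Finset.sdiff_subset_sdiff hXA subset_rfl) (hdis X)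
    have hec : e ≤ c := he.2.1.le_of_hasUpper hF.free hWne
      ⟨L, h₂, fun i hi B hB' => Finset.union_subset (hup i hi B hB').1
        (Finset.sdiff_subset.trans (hL.2 c hd i hi.2 hi.1 A hA B hB').1)⟩ subset_rfl (hdis A)
    obtain rfl : c = e := le_antisymm hce hec
    -- Here `A` cuts `W` with rank `c`, so maximality forces `A = X`, which is comparable to the
    -- added set.
    have hcard := hXmax A (Finset.mem_filter.2 ⟨hAF, ⟨hAd, hWA⟩, he⟩)
    have := Finset.eq_of_subset_of_card_le hXA hcard
    subst this
    exact hAS1 Finset.subset_union_left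
  have hcov : ∀ i < c, ∀ A ∈ L₁ i, A ⊂ X := fun i hi A hA => by
    have := hSsub A (hL₁L i hi A hA _ hSd) (hL₁W i hi A hA)
    refine ⟨this.trans Finset.sdiff_subset, fun h => hXd ((hdis X).mono_left (h.trans this))⟩
  refine hF.replace hXF hd hL hSd hmid' hL₁ h₂ hcov (fun i hi A hA B hB' => ?_)
    (fun i hi A hA => ⟨(hup i hi A hA).2, fun h => hXW ((hup i hi A hA).1.trans h)⟩)
    (fun i hi A hA B hB' => hL.2 c hd i hi.2 hi.1 B hB' A hA)
  refine ⟨hL₁L i hi A hA B hB', fun hBA => ?_⟩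
  by_cases hBS : B = X ∪ P
  · subst hBS
    exact (hcov i hi A hA).2 (Finset.subset_union_left.trans hBA)
  · exact (hmid' B hB' hBS).2.1 (hBA.trans (hcov i hi A hA).1)

/-- Rank `c` is attained, then attained by a member of `F` containing `W`, and a smallest such
member replaces the added set. Each stage needs a second set in layer `c`. -/
theorem IsLayerSaturated.false_of_isBalanced [Fintype α] (hF : IsLayerSaturated s k F)
    (hB : IsBalanced F W P) {c : ℕ} (hc : c < k) (hsc : 2 ≤ s c) : False := by
  classical
  have hWne : W.Nonempty := hB.nonempty.mono hB.ssubset.1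
  have hdis : ∀ A : Finset α, Disjoint (A \ W) W := fun A => Finset.sdiff_disjoint
  -- the rank `c` is attained
  have hatt : ∃ Z, Disjoint Z W ∧ IsRank s k F W c Z := by
    by_contra hcon
    push Not at hcon
    have htop : ∃ d, c < d ∧ ∃ Z, Disjoint Z W ∧ IsRank s k F W d Z := by
      obtain ⟨d, hd⟩ := hF.exists_isRank hB (hdis Finset.univ)
      refine ⟨d, ?_, _, hdis _, hd⟩
      -- A rank below `c` would put two distinct sets of layer `c` above the whole ground set.
      rcases lt_trichotomy d c with h | h | h
      · obtain ⟨L, hL, hLZ⟩ := hd.2.2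
        obtain ⟨-, hcard, -⟩ := hL.1 c ⟨h, hc⟩
        have hsub : L c ⊆ {Finset.univ} := fun A hA => by
          have := hLZ c ⟨h, hc⟩ A hA
          rw [Finset.union_sdiff_self_eq_union] at this
          exact Finset.mem_singleton.2
            (Finset.univ_subset_iff.1 (Finset.subset_union_right.trans this))
        have := Finset.card_le_card hsub
        rw [Finset.card_singleton] at this
        omega
      · exact absurd (h ▸ hd) (hcon _ (hdis _))
      · exact h
    obtain ⟨d₀, hd₀, Z₀, hZ₀⟩ := htop
    -- A smallest `Z` of rank above `c` properly contains some `l` of layer `c`. The layers below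
    -- `c` lie inside `l`, so `l` has rank at least `c`, hence above `c`, against minimality.
    obtain ⟨Z, hZ, hZmin⟩ := Finset.exists_min_image
      (Finset.univ.filter fun Z => ∃ d, c < d ∧ Disjoint Z W ∧ IsRank s k F W d Z) Finset.card
      ⟨Z₀, Finset.mem_filter.2 ⟨Finset.mem_univ _, d₀, hd₀, hZ₀⟩⟩
    obtain ⟨-, d, hcd, hZW, hZr⟩ := Finset.mem_filter.1 hZ
    obtain ⟨L, hL, hLZ⟩ := hZr.2.1
    obtain ⟨hLF, hLc, hLa⟩ := hL.1 c hcd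
    obtain ⟨l, hl, l', hl', hne⟩ := Finset.one_lt_card.1 (show 1 < (L c).card by omega)
    have hlZ : l ⊂ Z := by
      refine (hLZ c hcd l hl).ssubset_of_ne ?_
      rintro rfl
      exact hLa hl' hl hne.symm (hLZ c hcd l' hl')
    have hlW : Disjoint l W := hZW.mono_left hlZ.1
    obtain ⟨e, he⟩ := hF.exists_isRank hB hlW
    have hce : c ≤ e := by
      refine HasLower.le_of_hasUpper (Z := l) hF.free hWne ?_ he.2.2 subset_rfl hlW
      have hsub : Set.Iio c ⊆ Set.Iio d := Set.Iio_subset_Iio hcd.le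
      exact ⟨L, hL.mono hsub fun i hi => (hL.1 i (hsub hi)).1, fun i hi A hA =>
        (hL.2 i (hsub hi) c hcd hi A hA l hl).1⟩
    have hne' : c ≠ e := by
      rintro rfl
      exact hcon l hlW he
    have := hZmin l (Finset.mem_filter.2 ⟨Finset.mem_univ _, e, lt_of_le_of_ne hce hne', hlW, he⟩)
    exact absurd (Finset.card_lt_card hlZ) (not_lt.2 this)
  -- it is attained by a member of `F` containing `W`
  have hmem : ∃ A ∈ F, W ⊆ A ∧ IsRank s k F W c (A \ W) := by
    obtain ⟨Z₀, hZ₀⟩ := hatt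
    -- For a largest `Z`, a companion `A` of `P ∪ Z` in its layer has `A \ W ⊆ Z`. If `A` missed `W`
    -- it would lie inside `P ∪ Z`; so it contains `W`.
    obtain ⟨Z, hZ, hZmax⟩ := Finset.exists_max_image
      (Finset.univ.filter fun Z => Disjoint Z W ∧ IsRank s k F W c Z) Finset.card
      ⟨Z₀, Finset.mem_filter.2 ⟨Finset.mem_univ _, hZ₀⟩⟩
    obtain ⟨-, hZW, hZr⟩ := Finset.mem_filter.1 hZ
    obtain ⟨L, d, hr, hL, hSd, h₁, h₂, hmid, hlow, hup⟩ := hF.exists_copy_of_disjoint hB hZW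
    obtain rfl : c = d := le_antisymm (hZr.le hF.free hWne hr subset_rfl hZW)
      (hr.le hF.free hWne hZr subset_rfl hZW)
    obtain ⟨A, hA, hAS⟩ := Finset.exists_mem_ne
      (show 1 < (L c).card by rw [(hL.1 c hc).2.1]; omega) (P ∪ Z)
    obtain ⟨hAF, hA1, hA2⟩ := hmid A hA hAS
    have hrank : ∀ V, Disjoint V W → HasLower s F c V → V ⊆ Z ∪ A \ W → IsRank s k F W c V := by
      intro V hVW hV hVs
      refine ⟨hc, hV, L, h₂, fun i hi B hB' => Finset.union_subset
        (Finset.subset_union_left.trans (hup i hi B hB')) (hVs.trans (Finset.union_subset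
        (Finset.subset_union_right.trans (hup i hi B hB')) (Finset.sdiff_subset.trans
        (hL.2 c hc i hi.2 hi.1 A hA B hB').1)))⟩
    have hAZ : A \ W ⊆ Z := by
      have hd : Disjoint (Z ∪ A \ W) W := Finset.disjoint_union_left.2 ⟨hZW, hdis A⟩
      have := hZmax (Z ∪ A \ W) (Finset.mem_filter.2 ⟨Finset.mem_univ _, hd,
        hrank _ hd (hr.2.1.mono le_rfl Finset.subset_union_left) subset_rfl⟩)
      rw [Finset.eq_of_subset_of_card_le Finset.subset_union_left this]
      exact Finset.subset_union_right
    refine ⟨A, hAF, ?_, hrank _ (hdis A) ⟨L, h₁, fun i hi B hB' => ?_⟩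
      Finset.subset_union_right⟩
    · rcases hF.trivial_of_mem hB hAF with h | h
      · rw [Finset.sdiff_eq_self_of_disjoint h] at hAZ
        exact absurd (hAZ.trans Finset.subset_union_right) hA1
      · exact h
    · exact Finset.subset_sdiff.2 ⟨(hL.2 i (lt_trans hi hc) c hc hi B hB' A hA).1,
        hZW.mono_left (hlow i hi B hB')⟩
  obtain ⟨A₀, hA₀, hA₀'⟩ := hmem
  obtain ⟨A, hA, hAmin⟩ := Finset.exists_min_image
    (F.filter fun A => W ⊆ A ∧ IsRank s k F W c (A \ W)) Finset.card
    ⟨A₀, Finset.mem_filter.2 ⟨hA₀, hA₀'⟩⟩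
  obtain ⟨hAF, hWA, hAr⟩ := Finset.mem_filter.1 hA
  obtain ⟨L, d, hr, hL, hSd, h₁, h₂, hmid, hlow, hup⟩ :=
    hF.exists_copy_of_disjoint hB (hdis A)
  obtain rfl : c = d := le_antisymm (hAr.le hF.free hWne hr subset_rfl (hdis A))
    (hr.le hF.free hWne hAr subset_rfl (hdis A))
  have hSA : P ∪ A \ W ⊆ A :=
    Finset.union_subset (hB.ssubset.1.trans hWA) Finset.sdiff_subset
  have hupA : ∀ i ∈ Set.Ioo c k, ∀ B ∈ L i, A ⊆ B := fun i hi B hB' => by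
    have := hup i hi B hB'
    rw [Finset.union_sdiff_self_eq_union] at this
    exact Finset.subset_union_right.trans this
  have hmid' : ∀ B ∈ L c, B ≠ P ∪ A \ W → B ∈ F ∧ ¬ B ⊆ A ∧ ¬ A ⊆ B := by
    -- A companion `B ⊆ A` cannot miss `W`, so it contains `W` and has rank `c`. Minimality gives `B
    -- = A`, which contains the added set.
    intro B hB' hBS
    obtain ⟨hBF, hB1, hB2⟩ := hmid B hB' hBS
    refine ⟨hBF, fun h => ?_, fun h => hB2 (hSA.trans h)⟩
    rcases hF.trivial_of_mem hB hBF with hBW | hBW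
    · exact hB1 ((Finset.subset_sdiff.2 ⟨h, hBW⟩).trans Finset.subset_union_right)
    · have hBr : IsRank s k F W c (B \ W) := by
        refine ⟨hc, ⟨L, h₁, fun i hi C hC => Finset.subset_sdiff.2
          ⟨(hL.2 i (lt_trans hi hc) c hc hi C hC B hB').1, (hdis A).mono_left (hlow i hi C hC)⟩⟩,
          L, h₂, fun i hi C hC => ?_⟩
        rw [Finset.union_sdiff_of_subset hBW]
        exact (hL.2 c hc i hi.2 hi.1 B hB' C hC).1
      have hcard := hAmin B (Finset.mem_filter.2 ⟨hBF, hBW, hBr⟩)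
      obtain rfl := Finset.eq_of_subset_of_card_le h hcard
      exact hB2 hSA
  -- An upper set inside `A` would force `B₀ ⊆ A`; so `B₀` makes the inclusions above `A` strict.
  obtain ⟨B₀, hB₀, hB₀S⟩ := Finset.exists_mem_ne
    (show 1 < (L c).card by rw [(hL.1 c hc).2.1]; omega) (P ∪ A \ W)
  refine hF.replace hAF hc hL hSd hmid' h₁ h₂ (fun i hi C hC => ?_)
    (fun i hi C hC B hB' => hL.2 i (lt_trans hi hc) c hc hi C hC B hB')
    (fun i hi C hC => ⟨hupA i hi C hC, fun h => ?_⟩)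
    (fun i hi C hC B hB' => hL.2 c hc i hi.2 hi.1 B hB' C hC)
  · refine ⟨(hlow i hi C hC).trans Finset.sdiff_subset, fun h => ?_⟩
    obtain ⟨w, hw⟩ := hWne
    exact (Finset.mem_sdiff.1 (hlow i hi C hC (h (hWA hw)))).2 hw
  · exact (hmid' B₀ hB₀ hB₀S).2.1 ((hL.2 c hc i hi.2 hi.1 B₀ hB₀ C hC).1.trans h)

end Rank

theorem IsSaturated.le_card_add_one {k n : ℕ} {s : Fin k → ℕ} (hs : ∀ i, 0 < s i)
    (hs' : ¬ ∀ i, s i = 1) {F : Finset (Finset (Fin n))}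
    (hF : IsSaturated (MultipartitePoset s) F) : n ≤ F.card + 1 := by
  by_contra hlt
  obtain ⟨W, P, hB⟩ := exists_isBalanced F (by omega)
  push Not at hs'
  obtain ⟨c, hc⟩ := hs'
  have hsat : IsLayerSaturated (layerSize s) k F :=
    ⟨fun i hi => by rw [layerSize_of_lt s hi]; exact hs _,
      fun h => hF.1 ((hasInducedCopy_iff s F).2 h),
      fun S hS => (hasInducedCopy_iff s _).1 (by convert hF.2 S hS)⟩
  refine hsat.false_of_isBalanced hB c.2 ?_
  rw [layerSize_of_lt s c.2]
  have := hs c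
  change 2 ≤ s c
  omega

/-! ### A local lemma by counting -/

section Avoid

variable {V X : Type*} [Fintype V] [DecidableEq V] [DecidableEq X]

/-- Functions supported on `S`, with values in the lists `A`, none of whose constraints inside `S`
is violated. -/
def avoiding (A : V → Finset X) (ℬ : Finset (Finset (V × X))) (x₀ : X) (S : Finset V) :
    Finset (V → X) :=
  (Fintype.piFinset fun v => if v ∈ S then A v else {x₀}).filter
    fun f => ∀ b ∈ ℬ, (∀ p ∈ b, p.1 ∈ S) → ∃ p ∈ b, f p.1 ≠ p.2

theorem mem_avoiding {A : V → Finset X} {ℬ : Finset (Finset (V × X))} {x₀ : X} {S : Finset V}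
    {f : V → X} : f ∈ avoiding A ℬ x₀ S ↔ (∀ v ∈ S, f v ∈ A v) ∧ (∀ v ∉ S, f v = x₀) ∧
      ∀ b ∈ ℬ, (∀ p ∈ b, p.1 ∈ S) → ∃ p ∈ b, f p.1 ≠ p.2 := by
  rw [avoiding, Finset.mem_filter, Fintype.mem_piFinset, ← and_assoc]
  refine and_congr_left fun _ => ⟨fun h => ⟨fun v hv => ?_, fun v hv => ?_⟩, fun h v => ?_⟩
  · simpa [hv] using h v
  · simpa [hv] using h v
  · by_cases hv : v ∈ S
    · simpa [hv] using h.1 v hv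
    · simpa [hv] using h.2 v hv

/-- Iterates the one-variable growth bound over `D`, assuming it only below `S`, as a strong
induction provides it. -/
theorem card_avoiding_sdiff_le {A : V → Finset X} {ℬ : Finset (Finset (V × X))} {x₀ : X} {β : ℕ}
    {S : Finset V} (ih : ∀ S' ⊂ S, ∀ v ∉ S',
      β * (avoiding A ℬ x₀ S').card ≤ (avoiding A ℬ x₀ (insert v S')).card)
    (D : Finset V) (hD : D ⊆ S) :
    β ^ D.card * (avoiding A ℬ x₀ (S \ D)).card ≤ (avoiding A ℬ x₀ S).card := by
  induction D using Finset.induction_on with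
  | empty => simp
  | insert d D hd IH =>
    have hdS : d ∈ S := hD (Finset.mem_insert_self d D)
    have hDS : D ⊆ S := (Finset.subset_insert d D).trans hD
    have h1 := ih (S \ insert d D) ⟨Finset.sdiff_subset, fun h =>
      (Finset.mem_sdiff.1 (h hdS)).2 (Finset.mem_insert_self d D)⟩ d (by simp)
    have h2 : insert d (S \ insert d D) = S \ D := by
      ext x
      simp only [Finset.mem_insert, Finset.mem_sdiff]
      constructor
      · rintro (rfl | h)
        · exact ⟨hdS, hd⟩
        · exact ⟨h.1, fun h' => h.2 (Or.inr h')⟩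
      · rintro ⟨h, h'⟩
        by_cases hx : x = d
        · exact Or.inl hx
        · exact Or.inr ⟨h, fun h'' => h''.elim hx h'⟩
    rw [h2] at h1
    rw [Finset.card_insert_of_notMem hd, pow_succ]
    calc β ^ D.card * β * (avoiding A ℬ x₀ (S \ insert d D)).card
        = β ^ D.card * (β * (avoiding A ℬ x₀ (S \ insert d D)).card) := by ring
      _ ≤ β ^ D.card * (avoiding A ℬ x₀ (S \ D)).card := Nat.mul_le_mul_left _ h1
      _ ≤ _ := IH hDS

/-- A good assignment on `S` has at least `2 β` extensions to `v`. A bad extension violates some `b`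
through `v`, so `b` prescribes its values there and it is determined off the `e` other variables of
`b`; by induction each `b` spoils at most a `β ^ (-e)` multiple of the good count. The at most `β ^
(e + 1)` choices of `b` cost `β` times that count, leaving `β` times. -/
theorem card_avoiding_insert {A : V → Finset X} {ℬ : Finset (Finset (V × X))} {x₀ : X} {e β : ℕ}
    (hβ : 0 < β) (hA : ∀ v, 2 * β ≤ (A v).card)
    (hinj : ∀ b ∈ ℬ, Set.InjOn Prod.fst (b : Set (V × X))) (hcard : ∀ b ∈ ℬ, b.card = e + 1)
    (hdeg : ∀ v, (ℬ.filter fun b => v ∈ b.image Prod.fst).card ≤ β ^ (e + 1)) (S : Finset V) :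
    ∀ v ∉ S, β * (avoiding A ℬ x₀ S).card ≤ (avoiding A ℬ x₀ (insert v S)).card := by
  induction S using Finset.strongInduction with
  | H S ih =>
  intro v hv
  let E : Finset (V × X) → Finset (V → X) := fun b =>
    (Fintype.piFinset fun w => if w ∈ insert v S then A w else {x₀}).filter fun h =>
      (∀ b ∈ ℬ, (∀ p ∈ b, p.1 ∈ S) → ∃ p ∈ b, h p.1 ≠ p.2) ∧
        (∀ p ∈ b, p.1 ∈ insert v S) ∧ ∀ p ∈ b, h p.1 = p.2
  have hmemE : ∀ b h, h ∈ E b ↔ ((∀ w ∈ insert v S, h w ∈ A w) ∧ (∀ w ∉ insert v S, h w = x₀)) ∧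
      (∀ b ∈ ℬ, (∀ p ∈ b, p.1 ∈ S) → ∃ p ∈ b, h p.1 ≠ p.2) ∧
        (∀ p ∈ b, p.1 ∈ insert v S) ∧ ∀ p ∈ b, h p.1 = p.2 := by
    intro b h
    rw [Finset.mem_filter, Fintype.mem_piFinset]
    refine and_congr_left fun _ => ⟨fun h => ⟨fun v hv => ?_, fun v hv => ?_⟩, fun h w => ?_⟩
    · simpa only [hv, if_true] using h v
    · simpa only [hv, if_false, Finset.mem_singleton] using h v
    · by_cases hw : w ∈ insert v S
      · simpa only [hw, if_true] using h.1 w hw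
      · simpa only [hw, if_false, Finset.mem_singleton] using h.2 w hw
  -- the extensions of good functions
  have hsub : ((avoiding A ℬ x₀ S) ×ˢ (A v)).image (fun p => Function.update p.1 v p.2) ⊆
      avoiding A ℬ x₀ (insert v S) ∪
        (ℬ.filter fun b => v ∈ b.image Prod.fst).biUnion E := by
    intro h hh
    obtain ⟨⟨f, x⟩, hfx, rfl⟩ := Finset.mem_image.1 hh
    obtain ⟨hf, hx⟩ := Finset.mem_product.1 hfx
    obtain ⟨hf1, hf2, hf3⟩ := mem_avoiding.1 hf
    have hne : ∀ w, w ∈ S → Function.update f v x w = f w := fun w hw =>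
      Function.update_of_ne (by rintro rfl; exact hv hw) _ _
    have hu1 : ∀ w ∈ insert v S, Function.update f v x w ∈ A w := by
      intro w hw
      rcases Finset.mem_insert.1 hw with rfl | hw
      · simpa using hx
      · rw [hne w hw]
        exact hf1 w hw
    have hu2 : ∀ w ∉ insert v S, Function.update f v x w = x₀ := by
      intro w hw
      rw [Finset.mem_insert, not_or] at hw
      rw [Function.update_of_ne hw.1]
      exact hf2 w hw.2
    have hu3 : ∀ b ∈ ℬ, (∀ p ∈ b, p.1 ∈ S) → ∃ p ∈ b, Function.update f v x p.1 ≠ p.2 := by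
      intro b hb hbS
      obtain ⟨p, hp, hp'⟩ := hf3 b hb hbS
      exact ⟨p, hp, by rwa [hne _ (hbS p hp)]⟩
    rw [Finset.mem_union]
    by_cases hgood : ∀ b ∈ ℬ, (∀ p ∈ b, p.1 ∈ insert v S) →
        ∃ p ∈ b, Function.update f v x p.1 ≠ p.2
    · exact Or.inl (mem_avoiding.2 ⟨hu1, hu2, hgood⟩)
    · right
      push Not at hgood
      obtain ⟨b, hb, hbS, hbv⟩ := hgood
      refine Finset.mem_biUnion.2 ⟨b, Finset.mem_filter.2 ⟨hb, ?_⟩,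
        (hmemE b _).2 ⟨⟨hu1, hu2⟩, hu3, hbS, hbv⟩⟩
      by_contra hvb
      obtain ⟨p, hp, hp'⟩ := hu3 b hb fun p hp => by
        rcases Finset.mem_insert.1 (hbS p hp) with h | h
        · exact absurd (Finset.mem_image.2 ⟨p, hp, h⟩) hvb
        · exact h
      exact hp' (hbv p hp)
  have hcardimg : (((avoiding A ℬ x₀ S) ×ˢ (A v)).image
      (fun p => Function.update p.1 v p.2)).card = (avoiding A ℬ x₀ S).card * (A v).card := by
    rw [Finset.card_image_of_injOn, Finset.card_product]
    rintro ⟨f, x⟩ hf ⟨g, y⟩ hg hfg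
    have hf := (mem_avoiding.1 (Finset.mem_product.1 (Finset.mem_coe.1 hf)).1).2.1 v hv
    have hg := (mem_avoiding.1 (Finset.mem_product.1 (Finset.mem_coe.1 hg)).1).2.1 v hv
    simp only at hfg hf hg
    have hxy : x = y := by simpa using congrFun hfg v
    refine Prod.ext (funext fun w => ?_) hxy
    by_cases hw : w = v
    · subst hw
      exact hf.trans hg.symm
    · simpa [hw] using congrFun hfg w
  -- the bad extensions
  have hE : ∀ b ∈ ℬ.filter fun b => v ∈ b.image Prod.fst,
      β ^ e * (E b).card ≤ (avoiding A ℬ x₀ S).card := by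
    intro b hb
    obtain ⟨hb, hvb⟩ := Finset.mem_filter.1 hb
    by_cases hbS : ∀ p ∈ b, p.1 ∈ insert v S
    · have hDsub : (b.image Prod.fst).erase v ⊆ S := by
        intro w hw
        obtain ⟨hwv, hw⟩ := Finset.mem_erase.1 hw
        obtain ⟨p, hp, rfl⟩ := Finset.mem_image.1 hw
        exact (Finset.mem_insert.1 (hbS p hp)).resolve_left hwv
      have hDcard : ((b.image Prod.fst).erase v).card = e := by
        rw [Finset.card_erase_of_mem hvb, Finset.card_image_of_injOn (hinj b hb), hcard b hb]
        rfl
      have h1 := card_avoiding_sdiff_le ih ((b.image Prod.fst).erase v) hDsub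
      rw [hDcard] at h1
      refine le_trans (Nat.mul_le_mul_left _ ?_) h1
      set D := (b.image Prod.fst).erase v with hDdef
      -- Resetting `v` and `D` to the default `x₀` loses nothing, since `b` prescribes the values
      -- there.
      refine Finset.card_le_card_of_injOn (fun h w => if w ∈ S \ D then h w else x₀) ?_ ?_
      · intro h hh
        obtain ⟨⟨hh1, hh2⟩, hh3, -, -⟩ := (hmemE b h).1 hh
        refine Finset.mem_coe.2 (mem_avoiding.2 ⟨fun w hw => ?_, fun w hw => ?_,
          fun b' hb' hb'S => ?_⟩)
        · simp only [hw, if_true]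
          exact hh1 w (Finset.mem_insert_of_mem (Finset.mem_sdiff.1 hw).1)
        · simp only [hw, if_false]
        · obtain ⟨p, hp, hp'⟩ := hh3 b' hb' fun p hp => (Finset.mem_sdiff.1 (hb'S p hp)).1
          refine ⟨p, hp, ?_⟩
          simp only [hb'S p hp, if_true]
          exact hp'
      · intro h hh h' hh' heq
        obtain ⟨⟨-, hh2⟩, -, -, hh4⟩ := (hmemE b h).1 hh
        obtain ⟨⟨-, hh2'⟩, -, -, hh4'⟩ := (hmemE b h').1 hh'
        funext w
        by_cases hwb : w ∈ b.image Prod.fst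
        · obtain ⟨p, hp, rfl⟩ := Finset.mem_image.1 hwb
          rw [hh4 p hp, hh4' p hp]
        · by_cases hwS : w ∈ S
          · have hw : w ∈ S \ D := Finset.mem_sdiff.2 ⟨hwS, fun h =>
              hwb (Finset.mem_of_mem_erase h)⟩
            simpa only [hw, if_true] using congrFun heq w
          · have hw : w ∉ insert v S := by
              rw [Finset.mem_insert, not_or]
              exact ⟨fun h => hwb (h ▸ hvb), hwS⟩
            rw [hh2 w hw, hh2' w hw]
    · have : E b = ∅ := Finset.eq_empty_of_forall_notMem fun h hh =>
        hbS ((hmemE b h).1 hh).2.2.1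
      rw [this]
      simp
  have hsum : β ^ e * ∑ b ∈ ℬ.filter (fun b => v ∈ b.image Prod.fst), (E b).card ≤
      β ^ e * (β * (avoiding A ℬ x₀ S).card) := by
    rw [Finset.mul_sum]
    refine (Finset.sum_le_card_nsmul _ _ _ hE).trans ?_
    rw [smul_eq_mul, ← mul_assoc, ← pow_succ]
    exact Nat.mul_le_mul_right _ (hdeg v)
  have hsum' := Nat.le_of_mul_le_mul_left hsum (pow_pos hβ e)
  have htot := (Finset.card_le_card hsub).trans
    ((Finset.card_union_le _ _).trans (Nat.add_le_add_left Finset.card_biUnion_le _))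
  rw [hcardimg] at htot
  have h2 : (avoiding A ℬ x₀ S).card * (2 * β) ≤ (avoiding A ℬ x₀ S).card * (A v).card :=
    Nat.mul_le_mul_left _ (hA v)
  have h3 : (avoiding A ℬ x₀ S).card * (2 * β) =
    β * (avoiding A ℬ x₀ S).card + β * (avoiding A ℬ x₀ S).card := by ring
  omega

/-- A local lemma: if every variable has at least `2 β` values and lies in at most `β ^ (e + 1)`
of the forbidden partial assignments, which all have size `e + 1`, then some assignment extends
no forbidden one. -/
theorem exists_avoiding (A : V → Finset X) (ℬ : Finset (Finset (V × X))) {e β : ℕ}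
    (hβ : 0 < β) (hA : ∀ v, 2 * β ≤ (A v).card)
    (hinj : ∀ b ∈ ℬ, Set.InjOn Prod.fst (b : Set (V × X))) (hcard : ∀ b ∈ ℬ, b.card = e + 1)
    (hdeg : ∀ v, (ℬ.filter fun b => v ∈ b.image Prod.fst).card ≤ β ^ (e + 1)) :
    ∃ f : V → X, (∀ v, f v ∈ A v) ∧ ∀ b ∈ ℬ, ∃ p ∈ b, f p.1 ≠ p.2 := by
  have hpos : ∀ S : Finset V, ∀ x₀, (avoiding A ℬ x₀ S).Nonempty := by
    intro S x₀
    induction S using Finset.induction_on with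
    | empty =>
      refine ⟨fun _ => x₀, mem_avoiding.2 ⟨by simp, by simp, fun b hb hbS => ?_⟩⟩
      obtain ⟨p, hp⟩ := Finset.card_pos.1 (show 0 < b.card by rw [hcard b hb]; omega)
      exact absurd (hbS p hp) (Finset.notMem_empty _)
    | insert v S hv ih =>
      have := card_avoiding_insert (x₀ := x₀) hβ hA hinj hcard hdeg S v hv
      exact Finset.card_pos.1 (lt_of_lt_of_le (Nat.mul_pos hβ (Finset.card_pos.2 ih)) this)
  cases isEmpty_or_nonempty V with
  | inl h =>
    refine ⟨fun v => h.elim v, fun v => h.elim v, fun b hb => ?_⟩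
    obtain ⟨p, -⟩ := Finset.card_pos.1 (show 0 < b.card by rw [hcard b hb]; omega)
    exact h.elim p.1
  | inr h =>
    obtain ⟨v⟩ := h
    obtain ⟨x₀, -⟩ := Finset.card_pos.1 (lt_of_lt_of_le (Nat.mul_pos two_pos hβ) (hA v))
    obtain ⟨f, hf⟩ := hpos Finset.univ x₀
    obtain ⟨hf1, -, hf3⟩ := mem_avoiding.1 hf
    exact ⟨f, fun v => hf1 v (Finset.mem_univ v), fun b hb => hf3 b hb fun p _ => Finset.mem_univ _⟩

end Avoid

/-! ### Sparse covers -/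

theorem exists_disjoint_parts {α : Type*} [DecidableEq α] (M N : ℕ) (Y : Finset α)
    (h : N * M ≤ Y.card) :
    ∃ P : ℕ → Finset α, (∀ j < N, P j ⊆ Y ∧ (P j).card = M) ∧
      ∀ i < N, ∀ j < N, i ≠ j → Disjoint (P i) (P j) := by
  induction N generalizing Y with
  | zero => exact ⟨fun _ => ∅, by simp, by simp⟩
  | succ N ih =>
    obtain ⟨Q, hQY, hQ⟩ := Finset.exists_subset_card_eq
      (show M ≤ Y.card by rw [Nat.succ_mul] at h; omega)
    obtain ⟨P, hP, hPd⟩ := ih (Y \ Q) (by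
      rw [Finset.card_sdiff_of_subset hQY, hQ]; rw [Nat.succ_mul] at h; omega)
    refine ⟨fun j => if j = N then Q else P j, fun j hj => ?_, fun i hi j hj hij => ?_⟩
    · by_cases hjN : j = N
      · simpa [hjN] using ⟨hQY, hQ⟩
      · have := hP j (by omega)
        simpa [hjN] using ⟨this.1.trans Finset.sdiff_subset, this.2⟩
    · by_cases hiN : i = N <;> by_cases hjN : j = N
      · omega
      · simp only [hiN, hjN, if_true, if_false]
        exact (Finset.disjoint_sdiff.mono_right (hP j (by omega)).1)
      · simp only [hiN, hjN, if_true, if_false]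
        exact (Finset.disjoint_sdiff.mono_right (hP i (by omega)).1).symm
      · simp only [hiN, hjN, if_false]
        exact hPd i (by omega) j (by omega) hij

/-- `𝒴` is a family of `ρ`-subsets of `Y` such that every `(ρ - 1)`-subset of `Y` has `N`
extensions in `𝒴`, but the members of `𝒴` inside a `(ρ + N)`-subset of `Y` have `N` common
elements. -/
structure IsSparseCover {α : Type*} [DecidableEq α] (Y : Finset α) (ρ N : ℕ)
    (𝒴 : Finset (Finset α)) : Prop where
  subset : ∀ y ∈ 𝒴, y ⊆ Y
  card_eq : ∀ y ∈ 𝒴, y.card = ρ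
  exists_extensions : ∀ u ⊆ Y, u.card + 1 = ρ →
    ∃ I ⊆ Y \ u, I.card = N ∧ ∀ t ∈ I, insert t u ∈ 𝒴
  exists_common : ∀ T ⊆ Y, T.card = ρ + N → ∃ D ⊆ T, D.card = N ∧ ∀ y ∈ 𝒴, y ⊆ T → D ⊆ y

section SparseCover

variable {α : Type*}

/-- The pairs (variable, value) inside `T`. -/
def pairsIn (r N : ℕ) (T : Finset α) : Finset ((Finset α × Fin N) × α) :=
  ((T.powersetCard r) ×ˢ (Finset.univ : Finset (Fin N))) ×ˢ T

theorem mem_pairsIn {r N : ℕ} {T : Finset α} {p : (Finset α × Fin N) × α} :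
    p ∈ pairsIn r N T ↔ (p.1.1 ⊆ T ∧ p.1.1.card = r) ∧ p.2 ∈ T := by
  simp [pairsIn, Finset.mem_powersetCard]

theorem card_pairsIn {r N : ℕ} {T : Finset α} :
    (pairsIn r N T).card = T.card.choose r * N * T.card := by
  simp [pairsIn, Finset.card_product, Finset.card_powersetCard]

/-- The forbidden partial assignments. -/
def crowded [DecidableEq α] (Y : Finset α) (r N : ℕ) : Finset (Finset ((Finset α × Fin N) × α)) := by
  classical
  exact (Y.powersetCard (r + 1 + N)).biUnion fun T =>
    ((pairsIn r N T).powersetCard (N + 2)).filter fun b =>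
      Set.InjOn Prod.fst (b : Set ((Finset α × Fin N) × α))

theorem mem_crowded [DecidableEq α] {Y : Finset α} {r N : ℕ} {b : Finset ((Finset α × Fin N) × α)} :
    b ∈ crowded Y r N ↔ ∃ T, (T ⊆ Y ∧ T.card = r + 1 + N) ∧ (b ⊆ pairsIn r N T ∧
      b.card = N + 2) ∧ Set.InjOn Prod.fst (b : Set ((Finset α × Fin N) × α)) := by
  classical
  simp only [crowded, Finset.mem_biUnion, Finset.mem_powersetCard, Finset.mem_filter]

/-- The variable fixes all but `N + 1` elements of `T`. The exponent `N + 1` is one less than the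
size `N + 2` of a forbidden assignment, which is what the local lemma needs for large `Y`. -/
theorem card_crowded_filter_le [DecidableEq α] (Y : Finset α) (r N : ℕ) (v : Finset α × Fin N) :
    ((crowded Y r N).filter fun b => v ∈ b.image Prod.fst).card ≤
      Y.card ^ (N + 1) * 2 ^ ((r + 1 + N).choose r * N * (r + 1 + N)) := by
  classical
  have hsub : ((crowded Y r N).filter fun b => v ∈ b.image Prod.fst) ⊆
      ((Y.powersetCard (r + 1 + N)).filter fun T => v.1 ⊆ T ∧ v.1.card = r).biUnion
        fun T => (pairsIn r N T).powerset := by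
    intro b hb
    obtain ⟨hb, hv⟩ := Finset.mem_filter.1 hb
    obtain ⟨T, hT, ⟨hbT, -⟩, -⟩ := mem_crowded.1 hb
    obtain ⟨p, hp, rfl⟩ := Finset.mem_image.1 hv
    exact Finset.mem_biUnion.2 ⟨T, Finset.mem_filter.2 ⟨Finset.mem_powersetCard.2 hT,
      (mem_pairsIn.1 (hbT hp)).1⟩, Finset.mem_powerset.2 hbT⟩
  refine (Finset.card_le_card hsub).trans ((Finset.card_biUnion_le_card_mul _ _
    (2 ^ ((r + 1 + N).choose r * N * (r + 1 + N))) fun T hT => ?_).trans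
      (Nat.mul_le_mul_right _ ?_))
  · have := (Finset.mem_powersetCard.1 (Finset.mem_filter.1 hT).1).2
    rw [Finset.card_powerset, card_pairsIn, this]
  · refine le_trans (Finset.card_le_card_of_injOn (t := Y.powersetCard (N + 1))
      (fun T => T \ v.1) ?_ ?_) ?_
    · intro T hT
      obtain ⟨hT, hvT, hvc⟩ := Finset.mem_filter.1 (Finset.mem_coe.1 hT)
      obtain ⟨hTY, hTc⟩ := Finset.mem_powersetCard.1 hT
      refine Finset.mem_coe.2 (Finset.mem_powersetCard.2 ⟨Finset.sdiff_subset.trans hTY, ?_⟩)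
      rw [Finset.card_sdiff_of_subset hvT, hTc, hvc]
      omega
    · intro T hT T' hT' h
      have h1 := (Finset.mem_filter.1 (Finset.mem_coe.1 hT)).2.1
      have h2 := (Finset.mem_filter.1 (Finset.mem_coe.1 hT')).2.1
      rw [← Finset.sdiff_union_of_subset h1, ← Finset.sdiff_union_of_subset h2]
      simp only at h
      rw [h]
    · rw [Finset.card_powersetCard]
      exact Nat.choose_le_pow _ _

/-- Each `r`-set `u` is extended by `N` elements `f (u, j)`, distinct because they come from
disjoint parts of `Y`. The local lemma keeps `N + 2` pairs `(u, j)` from landing in one `(r + 1 +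
N)`-set `T`. The members inside `T` thus come from at most `N + 1` pairs and each omits `N` elements
of `T`, so at least `r + 1 + N - N (N + 1) ≥ N` elements are common. -/
theorem exists_isSparseCover (r N : ℕ) (hN : 1 ≤ N) (hr : N * (N + 1) ≤ r + 1) :
    ∃ m₀ : ℕ, ∀ (n : ℕ) (Y : Finset (Fin n)), m₀ ≤ Y.card → ∃ 𝒴, IsSparseCover Y (r + 1) N 𝒴 := by
  classical
  set C := 2 ^ ((r + 1 + N).choose r * N * (r + 1 + N)) with hC
  -- The first summand brings the degree bound `m ^ (N + 1) * C` below `β ^ (N + 2)`; the second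
  -- makes the parts large enough for `0 < β` and `M + 1 ≤ 4 * β`.
  refine ⟨C * (4 * N) ^ (N + 2) + N * (3 * r + 8), fun n Y hY => ?_⟩
  set m := Y.card with hm
  set M := m / N with hM
  have hNM : N * M ≤ m := Nat.mul_div_le m N
  have hmN : m < N * (M + 1) := Nat.lt_mul_div_succ m hN
  have hM' : 3 * r + 8 ≤ M := (Nat.le_div_iff_mul_le hN).2 (by
    rw [mul_comm]; exact (Nat.le_add_left _ _).trans hY)
  obtain ⟨P, hP, hPd⟩ := exists_disjoint_parts M N Y hNM
  set β := (M - r) / 2 with hβ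
  have hβ1 : 2 * β ≤ M - r := Nat.mul_div_le _ _
  have hβ2 : M - r < 2 * β + 2 := by omega
  have hmβ : m ≤ 4 * N * β := by
    calc m ≤ N * (M + 1) := hmN.le
      _ ≤ N * (4 * β) := Nat.mul_le_mul_left _ (by omega)
      _ = _ := by ring
  have hpos : 0 < β := by omega
  have h₁ : ∀ v : Finset (Fin n) × Fin N, 2 * β ≤
      (if v.1.card = r then P v.2 \ v.1 else P v.2).card := by
    intro v
    have hPv := (hP v.2 v.2.2).2
    by_cases hv : v.1.card = r
    · simp only [hv, if_true]
      have := Finset.le_card_sdiff v.1 (P v.2)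
      omega
    · simp only [hv, if_false]
      omega
  have h₂ : ∀ b ∈ crowded Y r N, Set.InjOn Prod.fst
      (b : Set ((Finset (Fin n) × Fin N) × Fin n)) := by
    intro b hb
    obtain ⟨T, -, -, h⟩ := mem_crowded.1 hb
    exact h
  have h₃ : ∀ b ∈ crowded Y r N, b.card = N + 1 + 1 := by
    intro b hb
    obtain ⟨T, -, h, -⟩ := mem_crowded.1 hb
    exact h.2
  have h₄ : ∀ v, ((crowded Y r N).filter fun b => v ∈ b.image Prod.fst).card ≤
      β ^ (N + 1 + 1) := by
    intro v
    refine (card_crowded_filter_le Y r N v).trans ?_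
    rw [← hC, ← hm]
    refine le_of_mul_le_mul_right ?_ (show 0 < (4 * N) ^ (N + 2) by positivity)
    calc m ^ (N + 1) * C * (4 * N) ^ (N + 2) = m ^ (N + 1) * (C * (4 * N) ^ (N + 2)) := by ring
      _ ≤ m ^ (N + 1) * m := Nat.mul_le_mul_left _ ((Nat.le_add_right _ _).trans hY)
      _ = m ^ (N + 2) := by ring
      _ ≤ (4 * N * β) ^ (N + 2) := Nat.pow_le_pow_left hmβ _
      _ = β ^ (N + 1 + 1) * (4 * N) ^ (N + 2) := by rw [mul_pow]; ring
  obtain ⟨f, hfA, hf⟩ := exists_avoiding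
    (fun v : Finset (Fin n) × Fin N => if v.1.card = r then P v.2 \ v.1 else P v.2)
    (crowded Y r N) hpos h₁ h₂ h₃ h₄
  have hfu : ∀ u : Finset (Fin n), u.card = r → ∀ j : Fin N, f (u, j) ∈ P j ∧ f (u, j) ∉ u := by
    intro u hu j
    have := hfA (u, j)
    simp only [hu, if_true] at this
    exact Finset.mem_sdiff.1 this
  refine ⟨((Y.powersetCard r) ×ˢ (Finset.univ : Finset (Fin N))).image
    (fun v => insert (f v) v.1), ?_, ?_, ?_, ?_⟩
  · intro y hy
    obtain ⟨⟨u, j⟩, hv, rfl⟩ := Finset.mem_image.1 hy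
    obtain ⟨huY, hu⟩ := Finset.mem_powersetCard.1 (Finset.mem_product.1 hv).1
    exact Finset.insert_subset ((hP j j.2).1 (hfu u hu j).1) huY
  · intro y hy
    obtain ⟨⟨u, j⟩, hv, rfl⟩ := Finset.mem_image.1 hy
    obtain ⟨huY, hu⟩ := Finset.mem_powersetCard.1 (Finset.mem_product.1 hv).1
    have hu : u.card = r := hu
    rw [Finset.card_insert_of_notMem (hfu u hu j).2, hu]
  · intro u huY hu
    have hu : u.card = r := by omega
    refine ⟨Finset.univ.image fun j => f (u, j), ?_, ?_, ?_⟩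
    · intro t ht
      obtain ⟨j, -, rfl⟩ := Finset.mem_image.1 ht
      exact Finset.mem_sdiff.2 ⟨(hP j j.2).1 (hfu u hu j).1, (hfu u hu j).2⟩
    · rw [Finset.card_image_of_injective, Finset.card_univ, Fintype.card_fin]
      intro i j hij
      by_contra hne
      have hij : f (u, i) = f (u, j) := hij
      refine Finset.disjoint_left.1 (hPd i i.2 j j.2 fun h => hne (Fin.ext h)) (hfu u hu i).1 ?_
      rw [hij]
      exact (hfu u hu j).1
    · intro t ht
      obtain ⟨j, -, rfl⟩ := Finset.mem_image.1 ht
      exact Finset.mem_image.2 ⟨(u, j), Finset.mem_product.2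
        ⟨Finset.mem_powersetCard.2 ⟨huY, hu⟩, Finset.mem_univ _⟩, rfl⟩
  · intro T hTY hT
    set Q := ((T.powersetCard r) ×ˢ (Finset.univ : Finset (Fin N))).filter fun v => f v ∈ T
      with hQ
    have hQmem : ∀ v, v ∈ Q ↔ (v.1 ⊆ T ∧ v.1.card = r) ∧ f v ∈ T := by
      intro v
      simp [hQ, Finset.mem_powersetCard]
    have hQc : Q.card ≤ N + 1 := by
      by_contra hlt
      obtain ⟨Q', hQ', hQ'c⟩ := Finset.exists_subset_card_eq (show N + 2 ≤ Q.card by omega)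
      have hb : Q'.image (fun v => (v, f v)) ∈ crowded Y r N := by
        refine mem_crowded.2 ⟨T, ⟨hTY, hT⟩, ⟨?_, ?_⟩, ?_⟩
        · intro p hp
          obtain ⟨v, hv, rfl⟩ := Finset.mem_image.1 hp
          exact mem_pairsIn.2 ((hQmem v).1 (hQ' hv))
        · rw [Finset.card_image_of_injective _ fun a b h => congrArg Prod.fst h, hQ'c]
        · intro p hp q hq hpq
          obtain ⟨v, hv, rfl⟩ := Finset.mem_image.1 (Finset.mem_coe.1 hp)
          obtain ⟨w, hw, rfl⟩ := Finset.mem_image.1 (Finset.mem_coe.1 hq)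
          have : v = w := hpq
          rw [this]
      obtain ⟨p, hp, hne⟩ := hf _ hb
      obtain ⟨v, -, rfl⟩ := Finset.mem_image.1 hp
      exact hne rfl
    set B := Q.biUnion fun v => T \ insert (f v) v.1 with hBdef
    have hB : B.card ≤ (N + 1) * N := by
      refine (Finset.card_biUnion_le_card_mul _ _ N fun v hv => ?_).trans
        (Nat.mul_le_mul_right _ hQc)
      obtain ⟨⟨h1, h2⟩, h3⟩ := (hQmem v).1 hv
      rw [Finset.card_sdiff_of_subset (Finset.insert_subset h3 h1),
        Finset.card_insert_of_notMem (hfu v.1 h2 v.2).2, hT, h2]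
      omega
    have hTB : N ≤ (T \ B).card := by
      have := Finset.le_card_sdiff B T
      rw [hT] at this
      have h' : (N + 1) * N = N * (N + 1) := by ring
      omega
    obtain ⟨D, hD, hDc⟩ := Finset.exists_subset_card_eq hTB
    refine ⟨D, hD.trans Finset.sdiff_subset, hDc, fun y hy hyT d hd => ?_⟩
    obtain ⟨v, hv, rfl⟩ := Finset.mem_image.1 hy
    by_contra hdy
    obtain ⟨hdT, hdB⟩ := Finset.mem_sdiff.1 (hD hd)
    refine hdB (Finset.mem_biUnion.2 ⟨v, (hQmem v).2 ⟨⟨?_, ?_⟩, ?_⟩, Finset.mem_sdiff.2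
      ⟨hdT, hdy⟩⟩)
    · exact (Finset.subset_insert _ _).trans hyT
    · exact (Finset.mem_powersetCard.1 (Finset.mem_product.1 hv).1).2
    · exact hyT (Finset.mem_insert_self _ _)

end SparseCover

/-! ### Templates contain no copy -/

section Template

variable {α : Type*} [DecidableEq α]

/-- The sets that a template offers for layer `i` among the subsets of `Y`. -/
def lowerSets (s lo : ℕ → ℕ) (Y : Finset α) (𝒴 : ℕ → Finset (Finset α)) (i : ℕ) :
    Finset (Finset α) :=
  if s i = 1 then Y.powersetCard (lo (i + 1))
  else {A ∈ Y.powersetCard (lo (i + 1) - 1) | ∀ y ∈ 𝒴 i, ¬ y ⊆ A}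

/-- The traces on `Y` of the sets that a template offers for layer `i` outside `Y`. -/
def upperTraces (s lo : ℕ → ℕ) (Y : Finset α) (𝒴 : ℕ → Finset (Finset α)) (i : ℕ) :
    Finset (Finset α) :=
  if s i = 1 then Y.powersetCard (lo i - 1) else 𝒴 i

/-- A family without a copy of the complete multipartite poset that offers, for every `Z ⊆ Y`, all
but one of the layers, the lower ones inside `Z` and the upper ones around `Z ∪ W`. -/
def template (s lo : ℕ → ℕ) (k : ℕ) (Y W : Finset α) (𝒴 : ℕ → Finset (Finset α)) :
    Finset (Finset α) :=
  (Finset.range (k - 1)).biUnion (lowerSets s lo Y 𝒴) ∪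
    (Finset.Ioo 0 k).biUnion fun i => (upperTraces s lo Y 𝒴 i).image (· ∪ W)

variable {s lo : ℕ → ℕ} {k N : ℕ} {Y W : Finset α} {𝒴 : ℕ → Finset (Finset α)}

theorem mem_template {A : Finset α} : A ∈ template s lo k Y W 𝒴 ↔
    (∃ j, j + 1 < k ∧ A ∈ lowerSets s lo Y 𝒴 j) ∨
      ∃ j, 0 < j ∧ j < k ∧ ∃ B ∈ upperTraces s lo Y 𝒴 j, B ∪ W = A := by
  simp only [template, Finset.mem_union, Finset.mem_biUnion, Finset.mem_range, Finset.mem_image,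
    Finset.mem_Ioo, Nat.lt_sub_iff_add_lt, and_assoc]

/-- The levels and sparse covers behind a template. -/
structure IsTemplate (s lo : ℕ → ℕ) (k N : ℕ) (Y W : Finset α) (𝒴 : ℕ → Finset (Finset α)) :
    Prop where
  size_pos : ∀ i < k, 0 < s i
  size_le : ∀ i < k, s i ≤ N
  two_le : 2 ≤ N
  lo_pos : 0 < lo 0
  lo_succ : ∀ i, lo (i + 1) = lo i + N
  disjoint : Disjoint Y W
  nonempty : W.Nonempty
  cover : ∀ i < k, IsSparseCover Y (lo i) N (𝒴 i)
  lo_le : lo k ≤ Y.card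

namespace IsTemplate

theorem lo_add_le (h : IsTemplate s lo k N Y W 𝒴) {i j : ℕ} (hij : i < j) : lo i + N ≤ lo j := by
  induction j, hij using Nat.le_induction with
  | base => exact (h.lo_succ i).ge
  | succ j _ ih => rw [h.lo_succ j]; omega

theorem le_of_lo_lt (h : IsTemplate s lo k N Y W 𝒴) {i j : ℕ} (hij : lo i < lo j + N) : i ≤ j := by
  by_contra hc
  have := h.lo_add_le (not_le.1 hc)
  omega

theorem lo_pos' (h : IsTemplate s lo k N Y W 𝒴) (i : ℕ) : 0 < lo i := by
  rcases Nat.eq_zero_or_pos i with rfl | hi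
  · exact h.lo_pos
  · have := h.lo_add_le hi; have := h.lo_pos; omega

theorem of_mem_lowerSets {A : Finset α} {j : ℕ} (hA : A ∈ lowerSets s lo Y 𝒴 j) :
    A ⊆ Y ∧ ((s j = 1 ∧ A.card = lo (j + 1)) ∨
      (s j ≠ 1 ∧ A.card = lo (j + 1) - 1 ∧ ∀ y ∈ 𝒴 j, ¬ y ⊆ A)) := by
  unfold lowerSets at hA
  split_ifs at hA with h1
  · rw [Finset.mem_powersetCard] at hA
    exact ⟨hA.1, Or.inl ⟨h1, hA.2⟩⟩
  · rw [Finset.mem_filter, Finset.mem_powersetCard] at hA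
    exact ⟨hA.1.1, Or.inr ⟨h1, hA.1.2, hA.2⟩⟩

theorem of_mem_upperTraces (h : IsTemplate s lo k N Y W 𝒴) {B : Finset α} {j : ℕ} (hj : j < k)
    (hB : B ∈ upperTraces s lo Y 𝒴 j) :
    B ⊆ Y ∧ ((s j = 1 ∧ B.card = lo j - 1) ∨ (s j ≠ 1 ∧ B.card = lo j ∧ B ∈ 𝒴 j)) := by
  unfold upperTraces at hB
  split_ifs at hB with h1
  · rw [Finset.mem_powersetCard] at hB
    exact ⟨hB.1, Or.inl ⟨h1, hB.2⟩⟩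
  · exact ⟨(h.cover j hj).subset B hB, Or.inr ⟨h1, (h.cover j hj).card_eq B hB, hB⟩⟩

theorem not_union_subset (h : IsTemplate s lo k N Y W 𝒴) (B : Finset α) : ¬ B ∪ W ⊆ Y := by
  intro hs
  obtain ⟨w, hw⟩ := h.nonempty
  exact Finset.disjoint_left.1 h.disjoint (hs (Finset.mem_union_right _ hw)) hw

theorem mem_of_subset (h : IsTemplate s lo k N Y W 𝒴) {A : Finset α}
    (hA : A ∈ template s lo k Y W 𝒴) (hAY : A ⊆ Y) :
    ∃ j, j + 1 < k ∧ A ∈ lowerSets s lo Y 𝒴 j := by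
  rcases mem_template.1 hA with h1 | ⟨j, -, -, B, -, rfl⟩
  · exact h1
  · exact absurd hAY (h.not_union_subset B)

theorem mem_of_not_subset {A : Finset α}
    (hA : A ∈ template s lo k Y W 𝒴) (hAY : ¬ A ⊆ Y) :
    ∃ j, 0 < j ∧ j < k ∧ ∃ B ∈ upperTraces s lo Y 𝒴 j, B ∪ W = A := by
  rcases mem_template.1 hA with ⟨j, -, hj⟩ | h1
  · exact absurd (of_mem_lowerSets hj).1 hAY
  · exact h1

theorem subset_of_subset_union (h : IsTemplate s lo k N Y W 𝒴) {A B : Finset α} (hA : A ⊆ Y)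
    (hAB : A ⊆ B ∪ W) : A ⊆ B := fun _ hx =>
  (Finset.mem_union.1 (hAB hx)).resolve_right (Finset.disjoint_left.1 h.disjoint (hA hx))

variable {L : ℕ → Finset (Finset α)}

/-- In a smaller `U` only sets of size `lo (i + 1) - 1` fit, and they all equal `U`. Such sets occur
only for `s i ≠ 1`, when the layer has two members. -/
theorem le_card_of_forall_mem (h : IsTemplate s lo k N Y W 𝒴)
    (hL : IsLayered s (Set.Iio k) (template s lo k Y W 𝒴) L) {i : ℕ} (hi : i < k)
    (ha : ∀ A ∈ L i, A ⊆ Y → ∃ j, i ≤ j ∧ j + 1 < k ∧ A ∈ lowerSets s lo Y 𝒴 j)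
    (hY : ∀ A ∈ L i, A ⊆ Y) {U : Finset α} (hU : ∀ A ∈ L i, A ⊆ U) : lo (i + 1) ≤ U.card := by
  by_contra hc
  have hbad : ∀ A ∈ L i, s i ≠ 1 ∧ A.card = lo (i + 1) - 1 := by
    intro A hA
    obtain ⟨j, hij, -, hAj⟩ := ha A hA (hY A hA)
    have hAU := Finset.card_le_card (hU A hA)
    obtain ⟨-, h1⟩ := of_mem_lowerSets hAj
    rcases hij.eq_or_lt with rfl | hij
    · rcases h1 with h1 | h1
      · omega
      · exact ⟨h1.1, h1.2.1⟩
    · have := h.lo_add_le (Nat.succ_lt_succ hij)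
      have := h.two_le
      rcases h1 with h1 | h1 <;> simp only [Nat.succ_eq_add_one] at * <;> omega
  have hcard := (hL.1 i hi).2.1
  have hpos := h.size_pos i hi
  obtain ⟨A, hA⟩ := Finset.card_pos.1 (hcard ▸ hpos)
  obtain ⟨B, hB, hBA⟩ := Finset.exists_mem_ne (s := L i)
    (by have := (hbad A hA).1; omega) A
  have hAU : A = U := Finset.eq_of_subset_of_card_le (hU A hA) (by have := hbad A hA; omega)
  have hBU : B = U := Finset.eq_of_subset_of_card_le (hU B hB) (by have := hbad B hB; omega)
  exact hBA (hBU.trans hAU.symm)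

/-- A set of layer `i + 1` contains the union of layer `i`, too large for the sets offered for
layers before `i`. One offered for `i` is large enough only if `s i = 1`; then layer `i` is a single
set of at least `lo (i + 1)` elements, which is not properly inside it. -/
theorem exists_mem_lowerSets (h : IsTemplate s lo k N Y W 𝒴)
    (hL : IsLayered s (Set.Iio k) (template s lo k Y W 𝒴) L) {i : ℕ} (hi : i < k) :
    ∀ A ∈ L i, A ⊆ Y → ∃ j, i ≤ j ∧ j + 1 < k ∧ A ∈ lowerSets s lo Y 𝒴 j := by
  induction i with
  | zero =>
    intro A hA hAY
    obtain ⟨j, hj, hA'⟩ := h.mem_of_subset ((hL.1 _ hi).1 hA) hAY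
    exact ⟨j, Nat.zero_le _, hj, hA'⟩
  | succ i ih =>
    intro A hA hAY
    have hi' : i < k := Nat.lt_of_succ_lt hi
    have hlt : ∀ B ∈ L i, B ⊂ A := fun B hB => hL.2 i hi' (i + 1) hi (Nat.lt_succ_self i) B hB A hA
    have hb : ∀ U, (∀ B ∈ L i, B ⊆ U) → lo (i + 1) ≤ U.card := fun U hU =>
      h.le_card_of_forall_mem hL hi' (ih hi') (fun B hB => (hlt B hB).1.trans hAY) hU
    obtain ⟨j, hj, hA'⟩ := h.mem_of_subset ((hL.1 _ hi).1 hA) hAY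
    refine ⟨j, ?_, hj, hA'⟩
    have h1 := hb A fun B hB => (hlt B hB).1
    obtain ⟨-, h2⟩ := of_mem_lowerSets hA'
    have h3 := h.two_le
    have h4 := h.lo_pos' (j + 1)
    have hij : i ≤ j := Nat.le_of_succ_le_succ (h.le_of_lo_lt (i := i + 1) (j := j + 1) (by omega))
    refine lt_of_le_of_ne hij ?_
    rintro rfl
    have hs1 : s i = 1 := by
      by_contra hne
      omega
    obtain ⟨B, hB⟩ := Finset.card_eq_one.1 ((hL.1 i hi').2.1.trans hs1)
    have h5 := hb B fun C hC => by
      rw [hB, Finset.mem_singleton] at hC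
      exact hC.subset
    have h6 := Finset.card_lt_card (hlt B (by simp [hB]))
    omega

/-- Dual to `le_card_of_forall_mem`: a larger `U` would force every member to be `U ∪ W`. -/
theorem card_lt_of_forall_mem (h : IsTemplate s lo k N Y W 𝒴)
    (hL : IsLayered s (Set.Iio k) (template s lo k Y W 𝒴) L) {i : ℕ} (hi : i < k)
    (ha : ∀ A ∈ L i, ¬ A ⊆ Y →
      ∃ j, j ≤ i ∧ 0 < j ∧ j < k ∧ ∃ B ∈ upperTraces s lo Y 𝒴 j, B ∪ W = A)
    (hY : ∀ A ∈ L i, ¬ A ⊆ Y) {U : Finset α} (hUY : U ⊆ Y) (hU : ∀ A ∈ L i, U ⊆ A) :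
    U.card < lo i := by
  by_contra hc
  have hbad : ∀ A ∈ L i, s i ≠ 1 ∧ A = U ∪ W := by
    intro A hA
    obtain ⟨j, hij, -, hjk, B, hB, hBA⟩ := ha A hA (hY A hA)
    have hUB := h.subset_of_subset_union hUY (hBA ▸ hU A hA)
    have hcard := Finset.card_le_card hUB
    obtain ⟨-, h1⟩ := h.of_mem_upperTraces hjk hB
    have h2 := h.lo_pos' j
    rcases hij.eq_or_lt with rfl | hij
    · rcases h1 with h1 | h1
      · omega
      · rw [Finset.eq_of_subset_of_card_le hUB (by omega), hBA]
        exact ⟨h1.1, rfl⟩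
    · have := h.lo_add_le hij
      have := h.two_le
      omega
  have hcard := (hL.1 i hi).2.1
  have hpos := h.size_pos i hi
  obtain ⟨A, hA⟩ := Finset.card_pos.1 (hcard ▸ hpos)
  obtain ⟨B, hB, hBA⟩ := Finset.exists_mem_ne (s := L i)
    (by have := (hbad A hA).1; omega) A
  exact hBA ((hbad B hB).2.trans (hbad A hA).2.symm)

/-- Dual to `exists_mem_lowerSets`; `d` counts the layers above `i`, so the induction runs down from
the top. -/
theorem exists_mem_upperTraces (h : IsTemplate s lo k N Y W 𝒴)
    (hL : IsLayered s (Set.Iio k) (template s lo k Y W 𝒴) L) (d : ℕ) {i : ℕ} (hi : i + d + 1 = k) :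
    ∀ A ∈ L i, ¬ A ⊆ Y →
      ∃ j, j ≤ i ∧ 0 < j ∧ j < k ∧ ∃ B ∈ upperTraces s lo Y 𝒴 j, B ∪ W = A := by
  induction d generalizing i with
  | zero =>
    intro A hA hAY
    obtain ⟨j, hj, hjk, hA'⟩ := mem_of_not_subset ((hL.1 _ (by simp; omega)).1 hA) hAY
    exact ⟨j, by omega, hj, hjk, hA'⟩
  | succ d ih =>
    intro A hA hAY
    have hi' : i < k := by omega
    have hik : i + 1 < k := by omega
    have hlt : ∀ B ∈ L (i + 1), A ⊂ B := hL.2 i hi' (i + 1) hik (Nat.lt_succ_self i) A hA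
    have hb : ∀ U ⊆ Y, (∀ B ∈ L (i + 1), U ⊆ B) → U.card < lo (i + 1) := fun U hUY hU =>
      h.card_lt_of_forall_mem hL hik (ih (by omega))
        (fun B hB hBY => hAY ((hlt B hB).1.trans hBY)) hUY hU
    obtain ⟨j, hj, hjk, A', hA', hAA'⟩ := mem_of_not_subset ((hL.1 _ hi').1 hA) hAY
    refine ⟨j, ?_, hj, hjk, A', hA', hAA'⟩
    obtain ⟨hA'Y, h2⟩ := h.of_mem_upperTraces hjk hA'
    have h1 := hb A' hA'Y fun B hB =>
      Finset.subset_union_left.trans (hAA'.subset.trans (hlt B hB).1)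
    have h3 := h.two_le
    have h4 := h.lo_pos' j
    have hij : j ≤ i + 1 := h.le_of_lo_lt (by omega)
    have hne : j ≠ i + 1 := ?_
    · omega
    rintro rfl
    have hs1 : s (i + 1) = 1 := by
      by_contra hne
      omega
    obtain ⟨B, hB⟩ := Finset.card_eq_one.1 ((hL.1 (i + 1) hik).2.1.trans hs1)
    have hBL : B ∈ L (i + 1) := by simp [hB]
    obtain ⟨j, -, -, hjk, B', hB', hBB'⟩ :=
      ih (i := i + 1) (by omega) B hBL fun hBY => hAY ((hlt B hBL).1.trans hBY)
    have hB'Y := (h.of_mem_upperTraces hjk hB').1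
    have h5 := hb B' hB'Y fun C hC => by
      rw [hB, Finset.mem_singleton] at hC
      rw [hC, ← hBB']
      exact Finset.subset_union_left
    have h6 : A' ⊆ B' := h.subset_of_subset_union hA'Y
      (Finset.subset_union_left.trans (hAA'.subset.trans ((hlt B hBL).1.trans hBB'.superset)))
    have h7 : A' = B' := Finset.eq_of_subset_of_card_le h6 (by omega)
    exact (hlt B hBL).ne (by rw [← hAA', ← hBB', h7])

/-- Let `c + 1` be the first layer with a set `y` not inside `Y`, and `U` the union of layer `c`, so
`lo (c + 1) ≤ |U|`. If the whole layer left `Y`, its common part would be too small to contain `U`.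
Otherwise it also has some `x ⊆ Y`; sizes force the trace of `y` to be `U`, a member of `𝒴 (c + 1)`,
and `x` to be a set offered as containing no such member, yet `U ⊆ x`. -/
theorem free (h : IsTemplate s lo k N Y W 𝒴) (hk : 0 < k) :
    ¬ ∃ L, IsLayered s (Set.Iio k) (template s lo k Y W 𝒴) L := by
  classical
  rintro ⟨L, hL⟩
  have hne : ∀ i < k, (L i).Nonempty := fun i hi =>
    Finset.card_pos.1 ((hL.1 i hi).2.1 ▸ h.size_pos i hi)
  have hex : ∃ i, i < k ∧ ∃ A ∈ L i, ¬ A ⊆ Y := by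
    refine ⟨k - 1, by omega, ?_⟩
    by_contra hcon
    push Not at hcon
    obtain ⟨A, hA⟩ := hne (k - 1) (by omega)
    obtain ⟨j, hj, hjk, -⟩ := h.exists_mem_lowerSets hL (by omega) A hA (hcon A hA)
    omega
  obtain ⟨hck, y, hy, hyY⟩ := Nat.find_spec hex
  have hmin : ∀ i < Nat.find hex, ∀ A ∈ L i, A ⊆ Y := by
    intro i hi A hA
    by_contra hcon
    exact Nat.find_min hex hi ⟨by omega, A, hA, hcon⟩
  generalize Nat.find hex = c at hck hy hmin
  obtain ⟨j, hjc, hj0, hjk, B, hB, hBy⟩ :=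
    h.exists_mem_upperTraces hL (k - 1 - c) (by omega) y hy hyY
  obtain ⟨hBY, hB'⟩ := h.of_mem_upperTraces hjk hB
  obtain ⟨c, rfl⟩ : ∃ d, c = d + 1 := ⟨c - 1, by omega⟩
  have hc : c < k := by omega
  have hlow : ∀ A ∈ L c, A ⊆ Y := hmin c (Nat.lt_succ_self c)
  have hlt : ∀ A ∈ L c, ∀ x ∈ L (c + 1), A ⊂ x := fun A hA x hx =>
    hL.2 c hc (c + 1) hck (Nat.lt_succ_self c) A hA x hx
  set U := (L c).sup id with hU
  have hUL : ∀ A ∈ L c, A ⊆ U := fun A hA => Finset.le_sup (f := id) hA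
  have hle : ∀ x, (∀ A ∈ L c, A ⊆ x) → U ⊆ x := fun x hx => Finset.sup_le hx
  have hUcard : lo (c + 1) ≤ U.card :=
    h.le_card_of_forall_mem hL hc (h.exists_mem_lowerSets hL hc) hlow hUL
  by_cases hall : ∀ A ∈ L (c + 1), ¬ A ⊆ Y
  · have := h.card_lt_of_forall_mem hL hck
      (h.exists_mem_upperTraces hL (k - 1 - (c + 1)) (by omega)) hall (hle Y hlow)
      fun x hx => hle x fun A hA => (hlt A hA x hx).1
    omega
  · push Not at hall
    obtain ⟨x, hx, hxY⟩ := hall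
    obtain ⟨l, hcl, hlk, hxl⟩ := h.exists_mem_lowerSets hL hck x hx hxY
    have hck' : c + 1 + 1 < k := by omega
    have hup : x.card < lo (c + 1 + 1) := by
      refine h.card_lt_of_forall_mem hL hck'
        (h.exists_mem_upperTraces hL (k - 1 - (c + 1 + 1)) (by omega)) (fun A hA hAY => ?_) hxY
        fun A hA => (hL.2 _ hck _ hck' (Nat.lt_succ_self _) x hx A hA).1
      exact hyY ((hL.2 _ hck _ hck' (Nat.lt_succ_self _) y hy A hA).1.trans hAY)
    have hUx : U ⊆ x := hle x fun A hA => (hlt A hA x hx).1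
    have hUB : U ⊆ B := h.subset_of_subset_union (hle Y hlow)
      (hle _ fun A hA => (hlt A hA y hy).1.trans hBy.superset)
    have hUB' := Finset.card_le_card hUB
    obtain ⟨-, hx'⟩ := of_mem_lowerSets hxl
    have h2 := h.two_le
    have h3 := h.lo_pos' j
    have h4 := h.lo_pos' (l + 1)
    have hjc' : c + 1 ≤ j := h.le_of_lo_lt (by omega)
    obtain rfl : j = c + 1 := le_antisymm hjc hjc'
    have hcl' : l + 1 ≤ c + 1 + 1 := h.le_of_lo_lt (by omega)
    obtain rfl : l = c + 1 := by omega
    have hUB'' : U = B := Finset.eq_of_subset_of_card_le hUB (by omega)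
    rcases hB' with hB' | hB'
    · omega
    · rcases hx' with hx' | hx'
      · omega
      · exact hx'.2.2 B hB'.2.2 (hUB''.symm.subset.trans hUx)

end IsTemplate
end Template

/-! ### Templates offer all layers but one -/

section Template

variable {α : Type*}

theorem HasLower.succ {s : ℕ → ℕ} {F : Finset (Finset α)} {c : ℕ} {Z Z' : Finset α}
    (h : HasLower s F c Z) {M : Finset (Finset α)} (hMF : M ⊆ F) (hMc : M.card = s c)
    (hMa : IsAntichain (· ⊆ ·) (M : Set (Finset α))) (hZ : ∀ B ∈ M, Z ⊂ B) (hZ' : ∀ B ∈ M, B ⊆ Z')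
    (hZZ' : Z ⊆ Z') : HasLower s F (c + 1) Z' := by
  obtain ⟨L, hL, hLZ⟩ := h
  have hcases : ∀ i < c + 1, i ≠ c → i < c := fun i hi hic => by omega
  refine ⟨fun i => if i = c then M else L i, ⟨?_, ?_⟩, ?_⟩
  · intro i hi
    by_cases hic : i = c
    · subst hic
      simpa using ⟨hMF, hMc, hMa⟩
    · simpa only [hic, if_false] using hL.1 i (hcases i hi hic)
  · intro i hi j hj hij A hA B hB
    have hj' : j < c + 1 := hj
    have hic : i ≠ c := by omega
    have hic' : i < c := by omega
    simp only [hic, if_false] at hA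
    by_cases hjc : j = c
    · simp only [hjc, if_true] at hB
      exact lt_of_le_of_lt (hLZ i hic' A hA) (hZ B hB)
    · simp only [hjc, if_false] at hB
      exact hL.2 i hic' j (hcases j hj hjc) hij A hA B hB
  · intro i hi A hA
    by_cases hic : i = c
    · simp only [hic, if_true] at hA
      exact hZ' A hA
    · simp only [hic, if_false] at hA
      exact (hLZ i (hcases i hi hic) A hA).trans hZZ'

theorem HasUpper.pred {s : ℕ → ℕ} {k : ℕ} {F : Finset (Finset α)} {c : ℕ} {Z Z' : Finset α}
    (h : HasUpper s k F (c + 1) Z) {M : Finset (Finset α)} (hMF : M ⊆ F)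
    (hMc : M.card = s (c + 1)) (hMa : IsAntichain (· ⊆ ·) (M : Set (Finset α)))
    (hZ : ∀ B ∈ M, B ⊂ Z) (hZ' : ∀ B ∈ M, Z' ⊆ B) (hZZ' : Z' ⊆ Z) : HasUpper s k F c Z' := by
  obtain ⟨L, hL, hLZ⟩ := h
  have hcases : ∀ i ∈ Set.Ioo c k, i ≠ c + 1 → i ∈ Set.Ioo (c + 1) k :=
    fun i hi hic => ⟨by have := hi.1; omega, hi.2⟩
  refine ⟨fun i => if i = c + 1 then M else L i, ⟨?_, ?_⟩, ?_⟩
  · intro i hi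
    by_cases hic : i = c + 1
    · subst hic
      simpa using ⟨hMF, hMc, hMa⟩
    · simpa only [hic, if_false] using hL.1 i (hcases i hi hic)
  · intro i hi j hj hij A hA B hB
    have hjc : j ≠ c + 1 := by have := hi.1; omega
    simp only [hjc, if_false] at hB
    by_cases hic : i = c + 1
    · simp only [hic, if_true] at hA
      exact lt_of_lt_of_le (hZ A hA) (hLZ j (hcases j hj hjc) B hB)
    · simp only [hic, if_false] at hA
      exact hL.2 i (hcases i hi hic) j (hcases j hj hjc) hij A hA B hB
  · intro i hi A hA
    by_cases hic : i = c + 1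
    · simp only [hic, if_true] at hA
      exact hZ' A hA
    · simp only [hic, if_false] at hA
      exact hZZ'.trans (hLZ i (hcases i hi hic) A hA)

theorem isAntichain_of_card_eq {M : Finset (Finset α)} {r : ℕ} (h : ∀ A ∈ M, A.card = r) :
    IsAntichain (· ⊆ ·) (M : Set (Finset α)) := fun A hA B hB hne hAB =>
  hne (Finset.eq_of_subset_of_card_le hAB (by rw [h A hA, h B hB]))

theorem ssubset_of_subset_of_card_lt {A B : Finset α} (h : A ⊆ B) (hc : A.card < B.card) : A ⊂ B :=
  Finset.ssubset_iff_subset_ne.2 ⟨h, fun he => hc.ne (by rw [he])⟩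

namespace IsTemplate

variable [DecidableEq α] {s lo : ℕ → ℕ} {k N : ℕ} {Y W : Finset α} {𝒴 : ℕ → Finset (Finset α)}

/-- To fill a layer `i` of size at least two, take `V ⊆ Z` with `lo (i + 1)` elements and `D` common
to the members of `𝒴 i` inside `V`. Deleting any one element of `D` destroys all of these members,
and `V \ D` keeps `lo i` elements for the layers below. -/
theorem hasLower (h : IsTemplate s lo k N Y W 𝒴) {i : ℕ} (hi : i < k) {Z : Finset α} (hZ : Z ⊆ Y)
    (hZi : i = 0 ∨ lo i ≤ Z.card) : HasLower s (template s lo k Y W 𝒴) i Z := by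
  induction i generalizing Z with
  | zero => exact ⟨fun _ => ∅, ⟨by simp, by simp⟩, by simp⟩
  | succ i ih =>
    have hi' : i < k := by omega
    have hsucc := h.lo_succ i
    have h2 := h.two_le
    obtain ⟨V, hVZ, hV⟩ := Finset.exists_subset_card_eq (hZi.resolve_left (Nat.succ_ne_zero i))
    have hVY := hVZ.trans hZ
    by_cases hs : s i = 1
    · obtain ⟨V', hV'V, hV'⟩ := Finset.exists_subset_card_eq (s := V) (n := lo i) (by omega)
      refine (ih hi' (hV'V.trans hVY) (Or.inr hV'.ge)).succ (M := {V}) ?_ (by simp [hs]) (by simp)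
        ?_ (by simpa using hVZ) (hV'V.trans hVZ)
      · rw [Finset.singleton_subset_iff, mem_template]
        refine Or.inl ⟨i, hi, ?_⟩
        rw [lowerSets, if_pos hs, Finset.mem_powersetCard]
        exact ⟨hVY, hV⟩
      · simpa using ssubset_of_subset_of_card_lt hV'V (by omega)
    · obtain ⟨D, hDV, hD, hDy⟩ := (h.cover i hi').exists_common V hVY (by omega)
      obtain ⟨D', hD'D, hD'⟩ := Finset.exists_subset_card_eq
        (s := D) (n := s i) (by rw [hD]; exact h.size_le i hi')
      have hcard : ∀ t ∈ D', (V.erase t).card = lo (i + 1) - 1 := fun t ht => by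
        rw [Finset.card_erase_of_mem (hDV (hD'D ht)), hV]
      have hV' : (V \ D).card = lo i := by rw [Finset.card_sdiff_of_subset hDV]; omega
      refine (ih hi' (Finset.sdiff_subset.trans hVY) (Or.inr hV'.ge)).succ (M := D'.image V.erase)
        ?_ ?_ (isAntichain_of_card_eq (r := lo (i + 1) - 1) ?_) ?_ ?_ (Finset.sdiff_subset.trans hVZ)
      · intro A hA
        obtain ⟨t, ht, rfl⟩ := Finset.mem_image.1 hA
        rw [mem_template]
        refine Or.inl ⟨i, hi, ?_⟩
        rw [lowerSets, if_neg hs, Finset.mem_filter, Finset.mem_powersetCard]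
        refine ⟨⟨(Finset.erase_subset t V).trans hVY, hcard t ht⟩, fun y hy hyV => ?_⟩
        exact Finset.notMem_erase t V
          (hyV (hDy y hy (hyV.trans (Finset.erase_subset t V)) (hD'D ht)))
      · rw [Finset.card_image_of_injOn, hD']
        exact (Finset.erase_injOn V).mono (Finset.coe_subset.2 (hD'D.trans hDV))
      · simpa using hcard
      · intro A hA
        obtain ⟨t, ht, rfl⟩ := Finset.mem_image.1 hA
        refine ssubset_of_subset_of_card_lt ?_ (by rw [hcard t ht]; omega)
        rw [← Finset.sdiff_singleton_eq_erase]
        exact Finset.sdiff_subset_sdiff subset_rfl (by simpa using hD'D ht)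
      · intro A hA
        obtain ⟨t, ht, rfl⟩ := Finset.mem_image.1 hA
        exact (Finset.erase_subset t V).trans hVZ

/-- Enlarge `Z` to `V` with `lo (i + 1) - 1` elements. If layer `i + 1` has size at least two, the
extensions of `V` in `𝒴 (i + 1)` fill it, and `V ∪ I`, with `lo (i + 2) - 1` elements, serves the
layers above. -/
theorem hasUpper (h : IsTemplate s lo k N Y W 𝒴) (d : ℕ) {i : ℕ} (hi : i + d + 1 = k)
    {Z : Finset α} (hZ : Z ⊆ Y) (hZi : d = 0 ∨ Z.card < lo (i + 1)) :
    HasUpper s k (template s lo k Y W 𝒴) i (Z ∪ W) := by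
  induction d generalizing i Z with
  | zero =>
    have hemp : ∀ j, j ∉ Set.Ioo i k := fun j hj => by have := hj.1; have := hj.2; omega
    exact ⟨fun _ => ∅, ⟨fun j hj => absurd hj (hemp j), fun j hj => absurd hj (hemp j)⟩,
      fun j hj => absurd hj (hemp j)⟩
  | succ d ih =>
    have hik : i + 1 < k := by omega
    have hsucc := h.lo_succ (i + 1)
    have h2 := h.two_le
    have hpos := h.lo_pos' (i + 1)
    have hloY : lo (i + 1 + 1) ≤ Y.card := by
      refine le_trans ?_ h.lo_le
      rcases (show i + 1 + 1 ≤ k from hik).eq_or_lt with he | hlt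
      · rw [he]
      · have := h.lo_add_le hlt; omega
    have hunion : ∀ {A : Finset α}, A ⊆ Y → (A ∪ W).card = A.card + W.card := fun hA =>
      Finset.card_union_of_disjoint (h.disjoint.mono_left hA)
    obtain ⟨V, hZV, hVY, hV⟩ := Finset.exists_subsuperset_card_eq (n := lo (i + 1) - 1) hZ
      (by omega) (by omega)
    by_cases hs : s (i + 1) = 1
    · obtain ⟨V', hVV', hV'Y, hV'⟩ := Finset.exists_subsuperset_card_eq
        (n := lo (i + 1 + 1) - 1) hVY (by omega) (by omega)
      refine (ih (i := i + 1) (by omega) hV'Y (Or.inr (by omega))).pred (M := {V ∪ W}) ?_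
        (by simp [hs]) (by simp) ?_ ?_ (Finset.union_subset_union_left (hZV.trans hVV'))
      · rw [Finset.singleton_subset_iff, mem_template]
        refine Or.inr ⟨i + 1, by omega, hik, V, ?_, rfl⟩
        rw [upperTraces, if_pos hs, Finset.mem_powersetCard]
        exact ⟨hVY, hV⟩
      · simp only [Finset.mem_singleton, forall_eq]
        exact ssubset_of_subset_of_card_lt (Finset.union_subset_union_left hVV')
          (by rw [hunion hVY, hunion hV'Y]; omega)
      · simp only [Finset.mem_singleton, forall_eq]
        exact Finset.union_subset_union_left hZV
    · obtain ⟨I, hIY, hI, hIy⟩ := (h.cover (i + 1) hik).exists_extensions V hVY (by omega)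
      obtain ⟨I', hI'I, hI'⟩ := Finset.exists_subset_card_eq
        (s := I) (n := s (i + 1)) (by rw [hI]; exact h.size_le _ hik)
      have hIV : Disjoint V I := Finset.disjoint_of_subset_right hIY Finset.disjoint_sdiff
      have hV'Y : V ∪ I ⊆ Y := Finset.union_subset hVY (hIY.trans Finset.sdiff_subset)
      have hV' : (V ∪ I).card = lo (i + 1) - 1 + N := by
        rw [Finset.card_union_of_disjoint hIV, hV, hI]
      have hnot : ∀ t ∈ I', t ∉ V := fun t ht => Finset.disjoint_right.1 hIV (hI'I ht)
      have hsub : ∀ t ∈ I', insert t V ⊆ V ∪ I := fun t ht =>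
        Finset.insert_subset (Finset.mem_union_right _ (hI'I ht)) Finset.subset_union_left
      have hcard : ∀ t ∈ I', (insert t V ∪ W).card = lo (i + 1) + W.card := fun t ht => by
        rw [hunion ((hsub t ht).trans hV'Y), Finset.card_insert_of_notMem (hnot t ht)]
        omega
      refine (ih (i := i + 1) (by omega) hV'Y (Or.inr (by omega))).pred
        (M := I'.image fun t => insert t V ∪ W) ?_ ?_
        (isAntichain_of_card_eq (r := lo (i + 1) + W.card) ?_) ?_ ?_
        (Finset.union_subset_union_left (hZV.trans Finset.subset_union_left))
      · intro A hA
        obtain ⟨t, ht, rfl⟩ := Finset.mem_image.1 hA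
        rw [mem_template]
        refine Or.inr ⟨i + 1, by omega, hik, insert t V, ?_, rfl⟩
        rw [upperTraces, if_neg hs]
        exact hIy t (hI'I ht)
      · rw [Finset.card_image_of_injOn, hI']
        intro t ht u hu htu
        have htu : insert t V ∪ W = insert u V ∪ W := htu
        have h3 : insert t V ⊆ insert u V := h.subset_of_subset_union ((hsub t ht).trans hV'Y)
          (Finset.subset_union_left.trans htu.subset)
        exact (Finset.mem_insert.1 (h3 (Finset.mem_insert_self t V))).resolve_right (hnot t ht)
      · simpa using hcard
      · intro A hA
        obtain ⟨t, ht, rfl⟩ := Finset.mem_image.1 hA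
        refine ssubset_of_subset_of_card_lt (Finset.union_subset_union_left (hsub t ht)) ?_
        rw [hcard t ht, hunion hV'Y]
        omega
      · intro A hA
        obtain ⟨t, ht, rfl⟩ := Finset.mem_image.1 hA
        exact Finset.union_subset_union_left (hZV.trans (Finset.subset_insert t V))

theorem exists_level (h : IsTemplate s lo k N Y W 𝒴) (hk : 0 < k) {Z : Finset α} (hZ : Z ⊆ Y) :
    ∃ c < k, HasLower s (template s lo k Y W 𝒴) c Z ∧
      HasUpper s k (template s lo k Y W 𝒴) c (Z ∪ W) := by
  suffices ∀ d < k, ∃ c ≤ d, (c = 0 ∨ lo c ≤ Z.card) ∧ (c = d ∨ Z.card < lo (c + 1)) by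
    obtain ⟨c, hc, h1, h2⟩ := this (k - 1) (by omega)
    exact ⟨c, by omega, h.hasLower (by omega) hZ h1,
      h.hasUpper (k - 1 - c) (by omega) hZ (h2.imp_left (by omega))⟩
  intro d hd
  induction d with
  | zero => exact ⟨0, le_rfl, Or.inl rfl, Or.inl rfl⟩
  | succ d ih =>
    obtain ⟨c, hc, h1, h2⟩ := ih (by omega)
    by_cases h3 : lo (d + 1) ≤ Z.card
    · exact ⟨d + 1, le_rfl, Or.inr h3, Or.inl rfl⟩
    · refine ⟨c, by omega, h1, Or.inr ?_⟩
      rcases h2 with rfl | h2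
      · omega
      · exact h2

end IsTemplate
end Template

/-! ### The upper bound and the conclusion -/

/-- Fix the trace `Z`. The sets `Z` and `Z ∪ Yᶜ` account for the 2; the others lie strictly between,
and `s c` of equal cardinality would be an antichain completing a copy. -/
theorem IsTemplate.card_le {n k N B : ℕ} {s lo : ℕ → ℕ} {Y : Finset (Fin n)}
    {𝒴 : ℕ → Finset (Finset (Fin n))} (h : IsTemplate s lo k N Y Yᶜ 𝒴) (hk : 0 < k)
    (hB : ∀ i < k, s i ≤ B + 1) {F : Finset (Finset (Fin n))}
    (hF : template s lo k Y Yᶜ 𝒴 ⊆ F) (hfree : ¬ ∃ L, IsLayered s (Set.Iio k) F L) :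
    F.card ≤ (2 + B * (n + 1)) * 2 ^ Y.card := by
  rw [← Finset.card_powerset]
  refine Finset.card_le_mul_card_image_of_maps_to (f := fun A => A ∩ Y)
    (fun A _ => Finset.mem_powerset.2 Finset.inter_subset_right) _ fun Z hZ => ?_
  have hZY := Finset.mem_powerset.1 hZ
  obtain ⟨c, hc, ⟨L₁, hL₁, hL₁Z⟩, L₂, hL₂, hL₂Z⟩ := h.exists_level hk hZY
  set G : Finset (Finset (Fin n)) := {A ∈ F | A ∩ Y = Z} with hG
  set G' := G \ {Z, Z ∪ Yᶜ} with hG'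
  have hmem : ∀ A ∈ G', A ∈ F ∧ Z ⊂ A ∧ A ⊂ Z ∪ Yᶜ := by
    intro A hA
    simp only [hG', hG, Finset.mem_sdiff, Finset.mem_filter, Finset.mem_insert,
      Finset.mem_singleton, not_or] at hA
    obtain ⟨⟨hAF, hAZ⟩, hne, hne'⟩ := hA
    refine ⟨hAF, Finset.ssubset_iff_subset_ne.2 ⟨?_, Ne.symm hne⟩,
      Finset.ssubset_iff_subset_ne.2 ⟨?_, hne'⟩⟩
    · exact hAZ ▸ Finset.inter_subset_left
    · intro x hx
      by_cases hxY : x ∈ Y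
      · exact Finset.mem_union_left _ (hAZ ▸ Finset.mem_inter.2 ⟨hx, hxY⟩)
      · exact Finset.mem_union_right _ (Finset.mem_compl.2 hxY)
  have hcard : G'.card ≤ B * (n + 1) := by
    have h1 := Finset.card_le_mul_card_image_of_maps_to (s := G') (t := Finset.range (n + 1))
      (f := Finset.card)
      (fun A _ => Finset.mem_range.2 (Nat.lt_succ_of_le (by simpa using Finset.card_le_univ A)))
      B fun t _ => ?_
    · rwa [Finset.card_range] at h1
    by_contra hcon
    obtain ⟨M, hM, hMc⟩ := Finset.exists_subset_card_eq
      (s := {A ∈ G' | A.card = t}) (n := s c) (by have := hB c hc; omega)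
    have hMG : ∀ A ∈ M, A ∈ G' ∧ A.card = t := fun A hA => Finset.mem_filter.1 (hM hA)
    refine hfree (IsLayered.glue_middle (M := M)
      (hL₁.mono subset_rfl fun i hi => (hL₁.1 i hi).1.trans hF)
      (hL₂.mono subset_rfl fun i hi => (hL₂.1 i hi).1.trans hF)
      (fun A hA => (hmem A (hMG A hA).1).1) hMc (h.size_pos c hc)
      (isAntichain_of_card_eq fun A hA => (hMG A hA).2) ?_ ?_)
    · intro i hi A hA A' hA'
      exact lt_of_le_of_lt (hL₁Z i hi A hA) (hmem A' (hMG A' hA').1).2.1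
    · intro i hi A hA A' hA'
      exact lt_of_lt_of_le (hmem A' (hMG A' hA').1).2.2 (hL₂Z i hi A hA)
  have h1 : G.card ≤ G'.card + _ := Finset.card_le_card_sdiff_add_card (t := {Z, Z ∪ Yᶜ})
  have h2 : ({Z, Z ∪ Yᶜ} : Finset (Finset (Fin n))).card ≤ 2 := Finset.card_le_two
  omega

theorem exists_isSaturated_superset {n : ℕ} {P : Type*} [PartialOrder P]
    {F₀ : Finset (Finset (Fin n))} (h : ¬ HasInducedCopy P F₀) :
    ∃ F, F₀ ⊆ F ∧ IsSaturated P F := by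
  classical
  obtain ⟨F, hF, hmax⟩ := Finset.exists_max_image
    (Finset.univ.filter fun F => F₀ ⊆ F ∧ ¬ HasInducedCopy P F) Finset.card
    ⟨F₀, Finset.mem_filter.2 ⟨Finset.mem_univ _, subset_rfl, h⟩⟩
  obtain ⟨-, hF₀, hF⟩ := Finset.mem_filter.1 hF
  refine ⟨F, hF₀, hF, fun S hS => ?_⟩
  by_contra hcon
  have h1 := hmax (insert S F) (Finset.mem_filter.2
    ⟨Finset.mem_univ _, hF₀.trans (Finset.subset_insert S F), by convert hcon⟩)
  rw [Finset.card_insert_of_notMem hS] at h1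
  omega

theorem exists_inducedSat_le {k : ℕ} (hk : 0 < k) {s : Fin k → ℕ} (hs : ∀ i, 0 < s i) {B : ℕ}
    (hB : ∀ i, s i ≤ B + 1) :
    ∃ m, ∀ n > m, inducedSat n (MultipartitePoset s) ≤ (2 + B * (n + 1)) * 2 ^ m := by
  -- `N` must bound the layer sizes and be at least 2, even for `B = 0`; starting `lo` at `N * (N +
  -- 1)` meets the hypothesis of `exists_isSparseCover`.
  set N := B + 2 with hN
  set lo : ℕ → ℕ := fun i => N * (N + 1) + N * i with hlo
  have hpos : ∀ i, 0 < lo i := fun i => by positivity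
  have hcover : ∀ i, ∃ m₀ : ℕ, ∀ (n : ℕ) (Y : Finset (Fin n)), m₀ ≤ Y.card →
      ∃ 𝒴, IsSparseCover Y (lo i) N 𝒴 := by
    intro i
    have h1 := Nat.sub_add_cancel (hpos i)
    have h2 := exists_isSparseCover (lo i - 1) N (by omega)
      (by rw [h1]; exact Nat.le_add_right _ _)
    rwa [h1] at h2
  choose m₀ hm₀ using hcover
  refine ⟨lo k + ∑ i ∈ Finset.range k, m₀ i, fun n hn => ?_⟩
  set m := lo k + ∑ i ∈ Finset.range k, m₀ i with hm
  obtain ⟨Y, -, hY⟩ := Finset.exists_subset_card_eq (s := (Finset.univ : Finset (Fin n))) (n := m)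
    (by simpa using hn.le)
  have hle : ∀ i < k, m₀ i ≤ Y.card := fun i hi => by
    have := Finset.single_le_sum (f := m₀) (fun _ _ => Nat.zero_le _) (Finset.mem_range.2 hi)
    omega
  have hex : ∀ i, ∃ 𝒴, i < k → IsSparseCover Y (lo i) N 𝒴 := fun i => by
    by_cases hi : i < k
    · obtain ⟨𝒴, h𝒴⟩ := hm₀ i n Y (hle i hi)
      exact ⟨𝒴, fun _ => h𝒴⟩
    · exact ⟨∅, fun h => absurd h hi⟩
  choose 𝒴 h𝒴 using hex
  have hsB : ∀ i < k, layerSize s i ≤ B + 1 := fun i hi => by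
    rw [layerSize_of_lt s hi]; exact hB _
  have hT : IsTemplate (layerSize s) lo k N Y Yᶜ 𝒴 :=
    { size_pos := fun i hi => by rw [layerSize_of_lt s hi]; exact hs _
      size_le := fun i hi => (hsB i hi).trans (by omega)
      two_le := by omega
      lo_pos := hpos 0
      lo_succ := fun i => by simp only [hlo]; ring
      disjoint := disjoint_compl_right
      nonempty := by
        rw [← Finset.card_pos, Finset.card_compl, Fintype.card_fin]
        omega
      cover := h𝒴
      lo_le := by omega }
  obtain ⟨F, hF, hsat⟩ := exists_isSaturated_superset
    (P := MultipartitePoset s) fun h => hT.free hk ((hasInducedCopy_iff s _).1 h)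
  have hcard := hT.card_le hk hsB hF fun h => hsat.1 ((hasInducedCopy_iff s F).2 h)
  rw [hY] at hcard
  have hle : inducedSat n (MultipartitePoset s) ≤ F.card := Nat.sInf_le ⟨F, hsat, rfl⟩
  exact hle.trans hcard

theorem le_inducedSat_add_one {k : ℕ} {s : Fin k → ℕ} (hs : ∀ i, 0 < s i)
    (hs' : ¬ ∀ i, s i = 1) (n : ℕ) : n ≤ inducedSat n (MultipartitePoset s) + 1 := by
  obtain ⟨i, hi⟩ := not_forall.1 hs'
  have : Nonempty (MultipartitePoset s) := ⟨⟨i, ⟨0, hs i⟩⟩⟩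
  obtain ⟨F₁, hF₁⟩ := exists_isSaturated n (MultipartitePoset s)
  obtain ⟨F, hF, hcard⟩ := Nat.sInf_mem
    (s := {c : ℕ | ∃ F : Finset (Finset (Fin n)), IsSaturated (MultipartitePoset s) F ∧ F.card = c})
    ⟨_, F₁, hF₁, rfl⟩
  rw [inducedSat, ← hcard]
  exact hF.le_card_add_one hs hs'

theorem mainTheorem3 (k : ℕ) (hk : 0 < k) (s : Fin k → ℕ) (hs : ∀ i, 0 < s i) :
    ((∀ i, s i = 1) →
      (fun n : ℕ => (inducedSat n (MultipartitePoset s) : ℝ)) =O[atTop] (fun _ : ℕ => (1 : ℝ))) ∧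
    ((¬ ∀ i, s i = 1) →
      (fun n : ℕ => (inducedSat n (MultipartitePoset s) : ℝ)) =Θ[atTop] (fun n : ℕ => (n : ℝ))) := by
  refine ⟨fun h1 => ?_, fun h1 => ⟨?_, ?_⟩⟩
  · obtain ⟨m, hm⟩ := exists_inducedSat_le hk hs (B := 0) fun i => (h1 i).le
    refine IsBigO.of_bound ((2 * 2 ^ m : ℕ) : ℝ) ?_
    filter_upwards [eventually_gt_atTop m] with n hn
    have h2 := hm n hn
    rw [Real.norm_natCast, norm_one, mul_one, Nat.cast_le]
    simpa using h2
  · obtain ⟨m, hm⟩ := exists_inducedSat_le hk hs (B := ∑ i, s i) fun i =>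
      (Finset.single_le_sum (fun _ _ => Nat.zero_le _) (Finset.mem_univ i)).trans (Nat.le_succ _)
    refine IsBigO.of_bound (((2 + 2 * ∑ i, s i) * 2 ^ m : ℕ) : ℝ) ?_
    filter_upwards [eventually_gt_atTop m] with n hn
    rw [Real.norm_natCast, Real.norm_natCast, ← Nat.cast_mul, Nat.cast_le]
    refine (hm n hn).trans ?_
    rw [mul_right_comm]
    refine Nat.mul_le_mul_right _ ?_
    have hn1 : 1 ≤ n := by omega
    nlinarith [Nat.zero_le (∑ i, s i)]
  · refine IsBigO.of_bound 2 ?_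
    filter_upwards [eventually_ge_atTop 2] with n hn
    have h2 := le_inducedSat_add_one hs h1 n
    rw [Real.norm_natCast, Real.norm_natCast]
    exact_mod_cast (by omega : n ≤ 2 * inducedSat n (MultipartitePoset s))
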